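/- **Notation.** Points of $\mathbb{R}^3=\mathbb{R}\times\mathbb{R}^2$ are written $(t,x)$, and $(\tau,\xi)$ on the Fourier side; $\langle r\rangle=(1+|r|^2)^{1/2}$; the letters $N,L$ (with or without indices) denote dyadic numbers $2^k$, $k=0,1,2,\dots$. For $0<c<1$ and a sign $\pm$ let $$K^{\pm}_{N,L}=\{(\tau,\xi): N\le\langle\xi\rangle\le 2N,\ L\le\langle\tau\pm|\xi|\rangle\le 2L\},\qquad K^{\pm,c}_{N,L}=\{(\tau,\xi): N\le\langle\xi\rangle\le 2N,\ L\le\langle\tau\pm c|\xi|\rangle\le 2L\},$$ and $P_K=\mathcal{F}^{-1}\chi_K\mathcal{F}$, where $\mathcal{F}f(\tau,\xi)=\int e^{-i(t\tau+x\cdot\xi)}f(t,x)\,dt\,dx$. For $s,b\in\mathbb{R}$ let $$\|f\|_{X^{s,b}_{\pm}}=\Big(\sum_{N,L}N^{2s}L^{2b}\|P_{K^{\pm}_{N,L}}f\|_{L^2}^2\Big)^{1/2},\qquad \|f\|_{X^{s,b}_{\pm,c}}=\Big(\sum_{N,L}N^{2s}L^{2b}\|P_{K^{\pm,c}_{N,L}}f\|_{L^2}^2\Big)^{1/2}.$$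 For $f,g_1,g_2\in\mathcal{S}(\mathbb{R}\times\mathbb{R}^2)$ (complex valued) and dyadic $N_0,N_1,N_2$ put $$I_1^-=\sum_{L_0,L_1,L_2}\Big|N_1^{-1}\int (P_{K^{\pm,c}_{N_0,L_0}}f)(P_{K^{-}_{N_1,L_1}}g_1)(P_{K^{-}_{N_2,L_2}}g_2)\,dt\,dx\Big|,$$ $$I_2^-=\sum_{L_0,L_1,L_2}\Big|N_0N_1^{-1}N_2^{-1}\int (P_{K^{\pm,c}_{N_0,L_0}}f)(P_{K^{-}_{N_1,L_1}}g_1)(P_{K^{-}_{N_2,L_2}}g_2)\,dt\,dx\Big|.$$ For $A\ge 1$ write $N\lesssim_A M$ if $N\le AM$, and $M\sim_A M'$ if $M\le AM'$ and $M'\le AM$. **Theorem.** For every $s\in(-\frac{13}{18},0)$ there is $b\in(\frac12,1)$ such that for every $c\in(0,1)$ and every $A\ge 1$ there is a constant $C<\infty$ with the following property: for either choice of the sign $\pm$ and all $f,g_1,g_2\in\mathcal{S}(\mathbb{R}\times\mathbb{R}^2)$, $$\Big(\sum_{N_0\lesssim_A N_1\sim_A N_2}+\sum_{N_1\lesssim_A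 N_0\sim_A N_2}+\sum_{N_2\lesssim_A N_0\sim_A N_1}\Big)I_1^-\ \le\ C\,\|f\|_{X^{s,b}_{\pm,c}}\|g_1\|_{X^{s,b}_-}\|g_2\|_{X^{-s,1-b}_-},$$ $$\Big(\sum_{N_0\lesssim_A N_1\sim_A N_2}+\sum_{N_1\lesssim_A N_0\sim_A N_2}+\sum_{N_2\lesssim_A N_0\sim_A N_1}\Big)I_2^-\ \le\ C\,\|f\|_{X^{-s,1-b}_{\pm,c}}\|g_1\|_{X^{s,b}_-}\|g_2\|_{X^{s,b}_-}.$$ Here each sum runs over all triples $(N_0,N_1,N_2)$ of dyadic numbers $\geq 1$ that satisfy the stated relations. -/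

import Mathlib

open MeasureTheory Set
open scoped ENNReal NNReal FourierTransform SchwartzMap

noncomputable section

/-- Space-time `ℝ × ℝ²`, as Euclidean `ℝ³`. Coordinate `0` is the time variable `t` (on the Fourier
side `τ`), coordinates `1, 2` are the space variable `x` (on the Fourier side `ξ`). -/
abbrev SpaceTime : Type := EuclideanSpace ℝ (Fin 3)

/-- The spatial component `ξ ∈ ℝ²` of a point `(τ, ξ)`. -/
def spatialPart (p : SpaceTime) : EuclideanSpace ℝ (Fin 2) := !₂[p 1, p 2]

/-- The Japanese bracket `⟨r⟩ = (1 + r²)^(1/2)`. -/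
def japaneseBracket (r : ℝ) : ℝ := Real.sqrt (1 + r ^ 2)

/-- The set of all `(τ, ξ)` with `N ≤ ⟨ξ⟩ ≤ 2N` and `L ≤ ⟨τ ± c|ξ|⟩ ≤ 2L`, where `±` is the sign
`ε`; this is `K^{±,c}_{N,L}`, and for `c = 1` it is `K^{±}_{N,L}`. -/
def dyadicRegion (ε : ℤˣ) (c N L : ℝ) : Set SpaceTime :=
  {p | (N ≤ japaneseBracket ‖spatialPart p‖ ∧ japaneseBracket ‖spatialPart p‖ ≤ 2 * N) ∧
    (L ≤ japaneseBracket (p 0 + ((ε : ℤ) : ℝ) * (c * ‖spatialPart p‖)) ∧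
      japaneseBracket (p 0 + ((ε : ℤ) : ℝ) * (c * ‖spatialPart p‖)) ≤ 2 * L)}

/-- The Fourier projection `P_K f = F⁻¹ (χ_K · F f)`, where `F` is the space-time Fourier transform
`F f (τ, ξ) = ∫ e^{-i (t τ + x · ξ)} f (t, x) dt dx`. The transform `𝓕` is
`𝓕 f (η) = ∫ e^{-2 π i ⟨v, η⟩} f (v) dv`, that is `F f (2 π η)`, so the multiplier `χ_K` in the
variable `(τ, ξ) = 2 π η` becomes `χ_K (2 π η)`. -/
def freqProj (K : Set SpaceTime) (f : 𝓢(SpaceTime, ℂ)) : SpaceTime → ℂ :=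
  𝓕⁻ (fun η : SpaceTime => K.indicator (fun _ => (1 : ℂ)) ((2 * Real.pi) • η) *
    𝓕 (f : SpaceTime → ℂ) η)

/-- The piece of `f` at dyadic frequency `N = 2^k` and dyadic modulation `L = 2^l` for the speed `c`
and the sign `ε`, that is `P_{K^{±,c}_{N,L}} f`. -/
def dyadicPiece (ε : ℤˣ) (c : ℝ) (k l : ℕ) (f : 𝓢(SpaceTime, ℂ)) : SpaceTime → ℂ :=
  freqProj (dyadicRegion ε c (2 ^ k) (2 ^ l)) f

/-- The norm `‖f‖_{X^{s,b}_{±,c}} = (∑_{N,L} N^{2s} L^{2b} ‖P_{K^{±,c}_{N,L}} f‖²_{L²})^{1/2}`, the sum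
over all dyadic `N, L ≥ 1`; for `c = 1` it is `‖f‖_{X^{s,b}_±}`. -/
def bourgainNorm (ε : ℤˣ) (c s b : ℝ) (f : 𝓢(SpaceTime, ℂ)) : ℝ≥0∞ :=
  (∑' (k : ℕ) (l : ℕ), ((2 : ℝ≥0∞) ^ k) ^ (2 * s) * ((2 : ℝ≥0∞) ^ l) ^ (2 * b) *
    eLpNorm (dyadicPiece ε c k l f) 2 volume ^ 2) ^ (1 / 2 : ℝ)

/-- The sum over the modulations `L₀, L₁, L₂` of
`|∫ (P_{K^{±,c}_{N₀,L₀}} f) (P_{K^-_{N₁,L₁}} g₁) (P_{K^-_{N₂,L₂}} g₂) dt dx|`, with `N_j = 2^{k_j}`. -/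
def modulationSum (ε : ℤˣ) (c : ℝ) (f g₁ g₂ : 𝓢(SpaceTime, ℂ)) (k₀ k₁ k₂ : ℕ) : ℝ≥0∞ :=
  ∑' (l₀ : ℕ) (l₁ : ℕ) (l₂ : ℕ), ‖∫ z : SpaceTime, dyadicPiece ε c k₀ l₀ f z *
    dyadicPiece (-1) 1 k₁ l₁ g₁ z * dyadicPiece (-1) 1 k₂ l₂ g₂ z‖ₑ

/-- `I₁⁻`: the modulation sum with the factor `N₁⁻¹`. -/
def trilinearOne (ε : ℤˣ) (c : ℝ) (f g₁ g₂ : 𝓢(SpaceTime, ℂ)) (k₀ k₁ k₂ : ℕ) : ℝ≥0∞ :=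
  ((2 : ℝ≥0∞) ^ k₁)⁻¹ * modulationSum ε c f g₁ g₂ k₀ k₁ k₂

/-- `I₂⁻`: the modulation sum with the factor `N₀ N₁⁻¹ N₂⁻¹`. -/
def trilinearTwo (ε : ℤˣ) (c : ℝ) (f g₁ g₂ : 𝓢(SpaceTime, ℂ)) (k₀ k₁ k₂ : ℕ) : ℝ≥0∞ :=
  (2 : ℝ≥0∞) ^ k₀ * ((2 : ℝ≥0∞) ^ k₁)⁻¹ * ((2 : ℝ≥0∞) ^ k₂)⁻¹ *
    modulationSum ε c f g₁ g₂ k₀ k₁ k₂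

/-- `N ≲ M ∼ M'` with implicit constant `A`, for `N = 2^i`, `M = 2^j`, `M' = 2^m`. -/
def LowHighHigh (A : ℝ) (i j m : ℕ) : Prop :=
  (2 : ℝ) ^ i ≤ A * 2 ^ j ∧ (2 : ℝ) ^ j ≤ A * 2 ^ m ∧ (2 : ℝ) ^ m ≤ A * 2 ^ j

/-- The sum over `N₀ ≲ N₁ ∼ N₂`, plus the sum over `N₁ ≲ N₀ ∼ N₂`, plus the sum over
`N₂ ≲ N₀ ∼ N₁`, of `I (N₀, N₁, N₂)`; all `N_j = 2^{k_j} ≥ 1` dyadic, implicit constants `A`. -/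
def dyadicSum (A : ℝ) (I : ℕ → ℕ → ℕ → ℝ≥0∞) : ℝ≥0∞ :=
  (∑' k : {k : ℕ × ℕ × ℕ // LowHighHigh A k.1 k.2.1 k.2.2}, I k.1.1 k.1.2.1 k.1.2.2) +
  (∑' k : {k : ℕ × ℕ × ℕ // LowHighHigh A k.2.1 k.1 k.2.2}, I k.1.1 k.1.2.1 k.1.2.2) +
  (∑' k : {k : ℕ × ℕ × ℕ // LowHighHigh A k.2.2 k.1 k.2.1}, I k.1.1 k.1.2.1 k.1.2.2)

end

/-! ### Plancherel and the convolution theorem for symbols in `L¹ ∩ L²`. -/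

section FourierInversion

variable {E : Type*} [NormedAddCommGroup E] [InnerProductSpace ℝ E] [FiniteDimensional ℝ E]
  [MeasurableSpace E] [BorelSpace E]

/-! On the Fourier side the integral runs over triples of frequencies with sum zero, two of them
near the cone `τ = |ξ|` and one near a cone of speed `c < 1`. The slower wave cannot balance the
other two: adding the three modulation relations gives `(1 - c)(|ξ₁| + |ξ₂|) ≤ 6 L`, where `L` is
the largest modulation. Hence `L` controls all three frequencies (`le_of_mem_dyadicRegion`), and
there is no resonant case.

The second ingredient is an `L²` bound in which the largest modulation does not appear. The factor
carrying it is put outermost; by Cauchy–Schwarz, what remains is the volume of the intersection of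
two thickened cones (`trilinearConv_le`). Slicing in time reduces this to a planar area. For
different speeds it is a level set of `|ξ| ± c|ξ' - ξ|` with thickness `h`, of area `O(r h)` in a
disc of radius `r`; for equal speeds it is a thickened ellipse, of area `O(R √(R h))`. Both follow
because the set, or each half of it or each of finitely many sectors, misses its own long translates
in a suitable direction (`volume_le_of_translates_disjoint`). The outcome is `N^{3/4}` times the
square root of the two smaller modulations, where `N` may be either `N₁` or `N₂`
(`exists_trilinearConv_le`). Being able to take the lower one is essential for unbalanced
frequencies, and `trilinearConv_le_of_localized` makes it possible.

Finally the norms leave a power of `L` close to `1/2`, which is traded for frequency. At `s =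
-13/18` the trade costs `L^{17/36}`, with `17/36 = 3/4 - 1 + 13/18 < 1/2` (`exists_exponent_le`).
The surplus pays for geometric series in all six dyadic indices. -/

theorem integral_fourierInv_mul_eq {f g : E → ℂ} (hf : Integrable f) (hg : Integrable g) :
    ∫ x, 𝓕⁻ g x * f x = ∫ x, g x * 𝓕⁻ f x := by
  have h := VectorFourier.integral_fourierIntegral_smul_eq_flip (L := innerₗ E)
    (μ := volume) (ν := volume) Real.continuous_fourierChar continuous_inner hg.comp_neg hf
  rw [flip_innerₗ] at h
  calc ∫ x, 𝓕⁻ g x * f x = ∫ x, 𝓕 (fun x => g (-x)) x • f x := by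
        rw [Real.fourierInv_eq_fourier_comp_neg]; rfl
    _ = ∫ x, g (-x) • 𝓕 f x := h
    _ = ∫ x, g (- -x) • 𝓕 f (-x) := (integral_neg_eq_self (fun x => g (-x) • 𝓕 f x) volume).symm
    _ = _ := by simp [Real.fourierInv_eq_fourier_neg]

theorem continuous_fourierInv {f : E → ℂ} (hf : Integrable f) : Continuous (𝓕⁻ f) := by
  have := VectorFourier.fourierIntegral_continuous (L := innerₗ E)
     Real.continuous_fourierChar continuous_inner hf
  have h2 : 𝓕⁻ f = fun x => 𝓕 f (-x) := funext fun x => Real.fourierInv_eq_fourier_neg f x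
  rw [h2]
  exact this.comp continuous_neg

/-- On `L¹ ∩ L²` the inverse Fourier transform of `L²` is given by the integral. -/
theorem coeFn_fourierInv_toLp {f : E → ℂ} (hf : Integrable f) (hf2 : MemLp f 2) :
    ((𝓕⁻ (hf2.toLp f) : Lp (α := E) ℂ 2 volume) : E → ℂ) =ᵐ[volume] 𝓕⁻ f := by
  refine ae_eq_of_integral_contDiff_smul_eq
    ((Lp.memLp _).locallyIntegrable (by norm_num))
    (continuous_fourierInv hf).locallyIntegrable fun g hg hgc => ?_
  let G : 𝓢(E, ℂ) := HasCompactSupport.toSchwartzMap (f := fun x => (g x : ℂ))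
    (hgc.comp_left (g := fun x : ℝ => (x : ℂ)) (by simp))
    (Complex.ofRealCLM.contDiff.comp hg)
  -- The `L²` transform agrees with the distributional one, which moves `𝓕⁻` onto the test function.
  have h1 := congrArg (fun T => T G) (Lp.fourierInv_toTemperedDistribution_eq (hf2.toLp f))
  simp only [TemperedDistribution.fourierInv_apply, Lp.toTemperedDistribution_apply] at h1
  have h2 : ∫ x, (𝓕⁻ G) x • (hf2.toLp f) x = ∫ x, (𝓕⁻ (G : E → ℂ)) x * f x := by
    refine integral_congr_ae ?_
    filter_upwards [hf2.coeFn_toLp] with x hx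
    rw [hx, SchwartzMap.fourierInv_coe, smul_eq_mul]
  rw [h2, integral_fourierInv_mul_eq hf G.integrable] at h1
  have hG : ∀ x, G x = (g x : ℂ) := fun x => rfl
  simpa only [hG, smul_eq_mul, Complex.real_smul] using h1.symm

theorem memLp_two_of_integrable_of_bound {f : E → ℂ} (hf : Integrable f) {B : ℝ}
    (hB : ∀ x, ‖f x‖ ≤ B) : MemLp f 2 := by
  rw [memLp_two_iff_integrable_sq_norm hf.aestronglyMeasurable]
  refine (hf.norm.const_mul B).mono' (hf.aestronglyMeasurable.norm.pow 2) (ae_of_all _ fun x => ?_)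
  rw [Real.norm_eq_abs, abs_of_nonneg (by positivity), sq]
  exact mul_le_mul_of_nonneg_right (hB x) (norm_nonneg _)

theorem eLpNorm_fourierInv {f : E → ℂ} (hf : Integrable f) (hf2 : MemLp f 2) :
    eLpNorm (𝓕⁻ f) 2 volume = eLpNorm f 2 volume := by
  have h := LinearIsometryEquiv.norm_map (Lp.fourierTransformₗᵢ E ℂ).symm (hf2.toLp f)
  have h' : ‖(𝓕⁻ (hf2.toLp f) : Lp (α := E) ℂ 2 volume)‖ₑ = ‖hf2.toLp f‖ₑ := by
    rw [← ofReal_norm, ← ofReal_norm]; exact congrArg _ h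
  rw [Lp.enorm_def, Lp.enorm_def] at h'
  rwa [eLpNorm_congr_ae (coeFn_fourierInv_toLp hf hf2), eLpNorm_congr_ae hf2.coeFn_toLp] at h'

theorem star_fourierInv (f : E → ℂ) (x : E) :
    starRingEnd ℂ (𝓕⁻ f x) = 𝓕⁻ (fun y => starRingEnd ℂ (f (-y))) x := by
  rw [Real.fourierInv_eq', Real.fourierInv_eq', ← integral_conj,
    ← integral_neg_eq_self _ volume]
  congr 1
  ext v
  simp [← Complex.exp_conj, Complex.conj_ofNat]

theorem integral_fourierInv_mul_fourierInv {f g : E → ℂ} (hf : Integrable f) (hf2 : MemLp f 2)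
    (hg : Integrable g) (hg2 : MemLp g 2) :
    ∫ x, 𝓕⁻ f x * 𝓕⁻ g x = ∫ x, f (-x) * g x := by
  -- Reflection and conjugation turn the bilinear pairing into an inner product, which the Fourier
  -- isometry preserves.
  let f' : E → ℂ := fun y => starRingEnd ℂ (f (-y))
  have hf' : Integrable f' := Complex.conjLIE.integrable_comp_iff.2 hf.comp_neg
  have hf2' : MemLp f' 2 := (hf2.comp_measurePreserving (Measure.measurePreserving_neg volume)).star
  have h := LinearIsometryEquiv.inner_map_map (Lp.fourierTransformₗᵢ E ℂ).symm (hf2'.toLp f') (hg2.toLp g)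
  have h' : inner ℂ (𝓕⁻ (hf2'.toLp f') : Lp (α := E) ℂ 2 volume) (𝓕⁻ (hg2.toLp g) : Lp (α := E) ℂ 2 volume) =
    inner ℂ (hf2'.toLp f') (hg2.toLp g) := h
  rw [L2.inner_def, L2.inner_def] at h'
  calc ∫ x, 𝓕⁻ f x * 𝓕⁻ g x = _ := by
        refine integral_congr_ae ?_
        filter_upwards [coeFn_fourierInv_toLp hf' hf2', coeFn_fourierInv_toLp hg hg2] with x hx hy
        rw [hx, hy, ← star_fourierInv]
        simp [mul_comm]
    _ = _ := h'
    _ = _ := by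
        refine integral_congr_ae ?_
        filter_upwards [hf2'.coeFn_toLp, hg2.coeFn_toLp] with x hx hy
        rw [hx, hy]
        simp [f', mul_comm]

/-- The trilinear form `∫∫ F₀ (-η) F₁ (t) F₂ (η - t)`. -/
noncomputable def trilinearConv (F₀ F₁ F₂ : E → ℝ≥0∞) : ℝ≥0∞ :=
  ∫⁻ η, F₀ (-η) * ∫⁻ t, F₁ t * F₂ (η - t)

open scoped Convolution in
-- The last two factors combine into the inverse transform of `G₁ ⋆ G₂`. Boundedness of `G₂` puts
-- this convolution in `L²`, so Plancherel applies to its pairing with `G₀`.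
theorem enorm_integral_fourierInv_mul_mul_le {G₀ G₁ G₂ : E → ℂ}
    (h0 : Integrable G₀) (h02 : MemLp G₀ 2) (h1 : Integrable G₁) (h2 : Integrable G₂)
    {B : ℝ} (hB : ∀ x, ‖G₂ x‖ ≤ B) :
    ‖∫ z, 𝓕⁻ G₀ z * 𝓕⁻ G₁ z * 𝓕⁻ G₂ z‖ₑ ≤
      trilinearConv (fun x => ‖G₀ x‖ₑ) (fun x => ‖G₁ x‖ₑ) (fun x => ‖G₂ x‖ₑ) := by
  set H : E → ℂ := G₁ ⋆[ContinuousLinearMap.mul ℂ ℂ] G₂ with hH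
  have hHi : Integrable H := h1.integrable_convolution _ h2
  have hHb : ∀ x, ‖H x‖ ≤ ∫ t, ‖G₁ t‖ * B := fun x => by
    rw [hH, convolution_def]
    refine norm_integral_le_of_norm_le (h1.norm.mul_const B) (ae_of_all _ fun t => ?_)
    simp only [ContinuousLinearMap.mul_apply', norm_mul]
    gcongr
    exact hB _
  have hH2 : MemLp H 2 := memLp_two_of_integrable_of_bound hHi hHb
  have e : ∀ z, 𝓕⁻ H z = 𝓕⁻ G₁ z * 𝓕⁻ G₂ z := fun z => by
    simp only [Real.fourierInv_eq_fourier_neg]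
    exact Real.fourier_mul_convolution_eq h1 h2 (-z)
  have : ∫ z, 𝓕⁻ G₀ z * 𝓕⁻ G₁ z * 𝓕⁻ G₂ z = ∫ z, G₀ (-z) * H z := by
    rw [← integral_fourierInv_mul_fourierInv h0 h02 hHi hH2]
    simp only [e, mul_assoc]
  rw [this, trilinearConv]
  refine (enorm_integral_le_lintegral_enorm _).trans (lintegral_mono fun η => ?_)
  rw [enorm_mul]
  gcongr
  rw [hH, convolution_def]
  refine (enorm_integral_le_lintegral_enorm _).trans (lintegral_mono fun t => ?_)
  simp [enorm_mul]

end FourierInversion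

/-! ### Cauchy–Schwarz for the trilinear form, global and localized. -/

section TrilinearConv

/-- The `L²` norm of a function with values in `[0, ∞]`. -/
noncomputable def lnorm {α : Type*} [MeasureSpace α] (F : α → ℝ≥0∞) : ℝ≥0∞ :=
  (∫⁻ x, F x ^ (2 : ℝ)) ^ (1 / 2 : ℝ)

theorem lnorm_rpow_two {α : Type*} [MeasureSpace α] (F : α → ℝ≥0∞) :
    lnorm F ^ (2 : ℝ) = ∫⁻ x, F x ^ (2 : ℝ) := by
  rw [lnorm, ← ENNReal.rpow_mul]; norm_num

theorem lintegral_mul_le_lnorm {α : Type*} [MeasureSpace α] {F G : α → ℝ≥0∞}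
    (hF : Measurable F) (hG : Measurable G) : ∫⁻ x, F x * G x ≤ lnorm F * lnorm G :=
  ENNReal.lintegral_mul_le_Lp_mul_Lq volume Real.HolderConjugate.two_two hF.aemeasurable
    hG.aemeasurable

theorem lintegral_le_of_volume_support_le {α : Type*} [MeasureSpace α] {F : α → ℝ≥0∞}
    (hF : Measurable F) {M : ℝ≥0∞} (hM : volume {x | F x ≠ 0} ≤ M) :
    ∫⁻ x, F x ≤ M ^ (1 / 2 : ℝ) * lnorm F := by
  have hS : MeasurableSet {x | F x ≠ 0} := (hF (measurableSet_singleton 0)).compl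
  have h := lintegral_mul_le_lnorm (measurable_one.indicator hS) hF
  have h1 : lnorm ({x | F x ≠ 0}.indicator 1) ≤ M ^ (1 / 2 : ℝ) := by
    unfold lnorm
    gcongr
    refine le_trans (le_of_eq ?_) hM
    rw [← lintegral_indicator_one hS]
    congr 1
    ext x
    by_cases hx : F x = 0 <;> simp [indicator, hx]
  refine le_trans (le_of_eq ?_) (h.trans (by gcongr))
  congr 1
  ext x
  by_cases hx : F x = 0 <;> simp [indicator, hx]

variable {E : Type*} [NormedAddCommGroup E] [InnerProductSpace ℝ E] [FiniteDimensional ℝ E]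
  [MeasurableSpace E] [BorelSpace E]

/-- The form integrates over triples with sum zero, so it is symmetric; this and the next two lemmas
allow any factor to be outermost. -/
theorem trilinearConv_swap_right (F₀ F₁ F₂ : E → ℝ≥0∞) :
    trilinearConv F₀ F₁ F₂ = trilinearConv F₀ F₂ F₁ := by
  unfold trilinearConv
  congr 1
  ext η
  rw [← lintegral_sub_left_eq_self _ η]
  simp [mul_comm]

theorem trilinearConv_swap_left {F₀ F₁ F₂ : E → ℝ≥0∞} (h0 : Measurable F₀) (h1 : Measurable F₁)
    (h2 : Measurable F₂) : trilinearConv F₀ F₁ F₂ = trilinearConv F₁ F₀ F₂ := by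
  unfold trilinearConv
  have e : ∀ η, F₀ (-η) * ∫⁻ t, F₁ t * F₂ (η - t) = ∫⁻ t, F₀ (-η) * (F₁ (-t) * F₂ (η + t)) := by
    intro η
    rw [lintegral_const_mul _ (by fun_prop), ← lintegral_neg_eq_self]
    simp
  simp_rw [e]
  rw [lintegral_lintegral_swap (by fun_prop)]
  congr 1
  ext t
  rw [← lintegral_const_mul _ (by fun_prop), ← lintegral_neg_eq_self]
  congr 1
  ext s
  simp only [neg_neg]
  rw [mul_left_comm, neg_add_eq_sub]

theorem trilinearConv_swap_outer {F₀ F₁ F₂ : E → ℝ≥0∞} (h0 : Measurable F₀) (h1 : Measurable F₁)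
    (h2 : Measurable F₂) : trilinearConv F₀ F₁ F₂ = trilinearConv F₂ F₁ F₀ := by
  rw [trilinearConv_swap_right, trilinearConv_swap_left h0 h2 h1, trilinearConv_swap_right]

/-- Cauchy–Schwarz in `t` on a set of measure at most `M`, then in `η`; by Tonelli the remaining
double integral of squares factors. -/
theorem trilinearConv_le {F₀ F₁ F₂ : E → ℝ≥0∞} (h0 : Measurable F₀) (h1 : Measurable F₁)
    (h2 : Measurable F₂) {M : ℝ≥0∞} (hM : ∀ η, volume {t | F₁ t ≠ 0 ∧ F₂ (η - t) ≠ 0} ≤ M) :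
    trilinearConv F₀ F₁ F₂ ≤ M ^ (1 / 2 : ℝ) * (lnorm F₀ * lnorm F₁ * lnorm F₂) := by
  set H : E → ℝ≥0∞ := fun η => lnorm (fun t => F₁ t * F₂ (η - t)) with hH
  have hHm : Measurable H := by
    unfold H lnorm
    refine Measurable.pow_const ?_ _
    exact Measurable.lintegral_prod_right' (f := fun p : E × E => (F₁ p.2 * F₂ (p.1 - p.2)) ^ (2:ℝ))
      (by fun_prop)
  have h3 : lnorm H = lnorm F₁ * lnorm F₂ := by
    unfold lnorm
    rw [← ENNReal.mul_rpow_of_nonneg _ _ (by norm_num)]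
    congr 1
    calc ∫⁻ η, H η ^ (2 : ℝ) = ∫⁻ η, ∫⁻ t, F₁ t ^ (2 : ℝ) * F₂ (η - t) ^ (2 : ℝ) := by
          simp_rw [hH, lnorm_rpow_two, ENNReal.mul_rpow_of_nonneg _ _ (zero_le_two (α := ℝ))]
      _ = ∫⁻ t, ∫⁻ η, F₁ t ^ (2 : ℝ) * F₂ (η - t) ^ (2 : ℝ) :=
          lintegral_lintegral_swap (by fun_prop)
      _ = ∫⁻ t, F₁ t ^ (2 : ℝ) * ∫⁻ η, F₂ η ^ (2 : ℝ) := by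
          congr 1
          ext t
          rw [lintegral_const_mul _ (by fun_prop),
            lintegral_sub_right_eq_self (fun η => F₂ η ^ (2 : ℝ)) t]
      _ = _ := lintegral_mul_const _ (by fun_prop)
  have h4 : lnorm (fun η => F₀ (-η)) = lnorm F₀ := by
    unfold lnorm
    rw [lintegral_neg_eq_self (fun x => F₀ x ^ (2 : ℝ))]
  calc trilinearConv F₀ F₁ F₂ ≤ ∫⁻ η, M ^ (1 / 2 : ℝ) * (F₀ (-η) * H η) := by
        refine lintegral_mono fun η => ?_
        rw [mul_left_comm]
        refine mul_le_mul_right (lintegral_le_of_volume_support_le (by fun_prop) ?_) _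
        simpa using hM η
    _ = M ^ (1 / 2 : ℝ) * ∫⁻ η, F₀ (-η) * H η := lintegral_const_mul _ (by fun_prop)
    _ ≤ M ^ (1 / 2 : ℝ) * (lnorm (fun η => F₀ (-η)) * lnorm H) := by
        gcongr
        exact lintegral_mul_le_lnorm (by fun_prop) hHm
    _ = _ := by rw [h3, h4, mul_assoc]

theorem volume_closedBall_two_mul (a b : EuclideanSpace ℝ (Fin 2)) (r : ℝ) :
    volume (Metric.closedBall a (2 * r)) = 4 * volume (Metric.closedBall b r) := by
  rw [EuclideanSpace.volume_closedBall_fin_two, EuclideanSpace.volume_closedBall_fin_two,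
    ENNReal.ofReal_mul zero_le_two]
  simp only [ENNReal.ofReal_ofNat]
  ring

/-- The part of `F` with `π t` in the ball of radius `r` about `a`. -/
noncomputable def localize (π : E →L[ℝ] EuclideanSpace ℝ (Fin 2)) (r : ℝ) (F : E → ℝ≥0∞)
    (a : EuclideanSpace ℝ (Fin 2)) (t : E) : ℝ≥0∞ :=
  F t * (Metric.closedBall (0 : EuclideanSpace ℝ (Fin 2)) r).indicator 1 (π t - a)

variable {π : E →L[ℝ] EuclideanSpace ℝ (Fin 2)} {r : ℝ}

omit [FiniteDimensional ℝ E] in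
theorem measurable_localize {F : E → ℝ≥0∞} (hF : Measurable F) :
    Measurable (fun p : EuclideanSpace ℝ (Fin 2) × E => localize π r F p.1 p.2) := by
  unfold localize
  refine (hF.comp measurable_snd).mul ?_
  exact (measurable_one.indicator Metric.isClosed_closedBall.measurableSet).comp (by fun_prop)

theorem lnorm_lnorm_localize {F : E → ℝ≥0∞} (hF : Measurable F) :
    lnorm (fun a => lnorm (localize π r F a)) =
      volume (Metric.closedBall (0 : EuclideanSpace ℝ (Fin 2)) r) ^ (1 / 2 : ℝ) * lnorm F := by
  unfold lnorm
  rw [← ENNReal.mul_rpow_of_nonneg _ _ (by norm_num)]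
  congr 1
  have hm := measurable_localize (π := π) (r := r) hF
  calc _ = ∫⁻ a, ∫⁻ t, localize π r F a t ^ (2 : ℝ) := by
        congr 1; ext a; exact lnorm_rpow_two _
    _ = ∫⁻ t, ∫⁻ a, localize π r F a t ^ (2 : ℝ) :=
        lintegral_lintegral_swap (hm.pow_const 2).aemeasurable
    _ = ∫⁻ t, volume (Metric.closedBall (0 : EuclideanSpace ℝ (Fin 2)) r) * F t ^ (2 : ℝ) := by
        congr 1
        ext t
        have h2 : ∀ a, localize π r F a t ^ (2 : ℝ) = F t ^ (2 : ℝ) *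
            (Metric.closedBall (0 : EuclideanSpace ℝ (Fin 2)) r).indicator 1 (π t - a) := by
          intro a
          unfold localize
          rw [ENNReal.mul_rpow_of_nonneg _ _ zero_le_two]
          congr 1
          by_cases h : π t - a ∈ Metric.closedBall (0 : EuclideanSpace ℝ (Fin 2)) r <;>
            simp [indicator, h]
        simp_rw [h2]
        have hi : Measurable ((Metric.closedBall (0 : EuclideanSpace ℝ (Fin 2)) r).indicator
          (1 : EuclideanSpace ℝ (Fin 2) → ℝ≥0∞)) := measurable_one.indicator Metric.isClosed_closedBall.measurableSet
        rw [lintegral_const_mul _ (by fun_prop), lintegral_sub_left_eq_self,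
          lintegral_indicator_one Metric.isClosed_closedBall.measurableSet, mul_comm]
    _ = _ := lintegral_const_mul _ (by fun_prop)

theorem measurable_lnorm_localize {F : E → ℝ≥0∞} (hF : Measurable F) :
    Measurable (fun a => lnorm (localize π r F a)) := by
  unfold lnorm
  refine Measurable.pow_const ?_ _
  exact Measurable.lintegral_prod_right' ((measurable_localize (π := π) (r := r) hF).pow_const 2)

/-- If `F₀` lives where `‖π η‖ ≤ r`, the support condition is only needed on balls of radius `r`. -/
theorem trilinearConv_le_of_localized {F₀ F₁ F₂ : E → ℝ≥0∞} (h0 : Measurable F₀)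
    (h1 : Measurable F₁) (h2 : Measurable F₂) (hr : 0 < r) (hF0 : ∀ η, F₀ η ≠ 0 → ‖π η‖ ≤ r)
    {M : ℝ≥0∞} (hM : ∀ η a, volume {t | ‖π t - a‖ ≤ r ∧ F₁ t ≠ 0 ∧ F₂ (η - t) ≠ 0} ≤ M) :
    trilinearConv F₀ F₁ F₂ ≤ 2 * M ^ (1 / 2 : ℝ) * (lnorm F₀ * lnorm F₁ * lnorm F₂) := by
  set V := volume (Metric.closedBall (0 : EuclideanSpace ℝ (Fin 2)) r) with hV
  have hV0 : V ≠ 0 := (Metric.measure_closedBall_pos _ _ hr).ne'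
  have hVt : V ≠ ⊤ := measure_closedBall_lt_top.ne
  have m1 := measurable_localize (π := π) (r := r) h1
  have m2 := measurable_localize (π := π) (r := 2 * r) h2
  -- Average over the centre `a`: each `t` is counted with weight `V`. Since the outer frequency
  -- projects into radius `r`, `π t` near `a` forces `π (η - t)` to lie within `2 r` of `-a`.
  have lower : trilinearConv F₀ F₁ F₂ * V ≤
      ∫⁻ a, trilinearConv F₀ (localize π r F₁ a) (localize π (2 * r) F₂ (-a)) := by
    unfold trilinearConv
    rw [lintegral_lintegral_swap, ← lintegral_mul_const' _ _ hVt]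
    · refine lintegral_mono fun η => ?_
      rcases eq_or_ne (F₀ (-η)) 0 with h | h
      · simp [h]
      have hη := hF0 _ h
      rw [map_neg, norm_neg] at hη
      rw [lintegral_const_mul, mul_assoc]
      · gcongr
        rw [lintegral_lintegral_swap, ← lintegral_mul_const' _ _ hVt]
        · refine lintegral_mono fun t => ?_
          have hi : Measurable ((Metric.closedBall (0 : EuclideanSpace ℝ (Fin 2)) r).indicator
            (1 : EuclideanSpace ℝ (Fin 2) → ℝ≥0∞)) := measurable_one.indicator Metric.isClosed_closedBall.measurableSet
          have h3 : ∀ a, localize π r F₁ a t * localize π (2 * r) F₂ (-a) (η - t) =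
              F₁ t * F₂ (η - t) *
                (Metric.closedBall (0 : EuclideanSpace ℝ (Fin 2)) r).indicator 1 (π t - a) := by
            intro a
            unfold localize
            by_cases h : π t - a ∈ Metric.closedBall (0 : EuclideanSpace ℝ (Fin 2)) r
            · have h' : π (η - t) - -a ∈ Metric.closedBall (0 : EuclideanSpace ℝ (Fin 2))
                  (2 * r) := by
                rw [mem_closedBall_zero_iff] at h ⊢
                have : π (η - t) - -a = π η - (π t - a) := by rw [map_sub]; abel
                rw [this]
                linarith [norm_sub_le (π η) (π t - a)]
              rw [indicator_of_mem h, indicator_of_mem h']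
              simp
            · rw [indicator_of_notMem h]
              simp
          simp_rw [h3]
          rw [lintegral_const_mul _ (by fun_prop), lintegral_sub_left_eq_self,
            lintegral_indicator_one Metric.isClosed_closedBall.measurableSet]
        · refine Measurable.aemeasurable ?_
          exact (m1.comp (by fun_prop : Measurable fun p : EuclideanSpace ℝ (Fin 2) × E =>
            (p.1, p.2))).mul (m2.comp (by fun_prop : Measurable fun p : EuclideanSpace ℝ (Fin 2) × E =>
            (-p.1, η - p.2)))
      · refine Measurable.lintegral_prod_right' (f := fun p : EuclideanSpace ℝ (Fin 2) × E =>
          localize π r F₁ p.1 p.2 * localize π (2 * r) F₂ (-p.1) (η - p.2)) ?_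
        exact m1.mul (m2.comp (by fun_prop : Measurable fun p : EuclideanSpace ℝ (Fin 2) × E =>
            (-p.1, η - p.2)))
    · refine Measurable.aemeasurable ?_
      refine (h0.comp (by fun_prop)).mul ?_
      refine Measurable.lintegral_prod_right' (f := fun p : (EuclideanSpace ℝ (Fin 2) × E) × E =>
          localize π r F₁ p.1.1 p.2 * localize π (2 * r) F₂ (-p.1.1) (p.1.2 - p.2)) ?_
      exact (m1.comp (by fun_prop : Measurable fun p : (EuclideanSpace ℝ (Fin 2) × E) × E =>
            (p.1.1, p.2))).mul (m2.comp (by fun_prop :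
            Measurable fun p : (EuclideanSpace ℝ (Fin 2) × E) × E => (-p.1.1, p.1.2 - p.2)))
  -- For fixed `a` only the localized support condition is needed. Cauchy–Schwarz in `a` recombines
  -- the pieces; the factor `2` is the square root of the area ratio of the two discs.
  have upper : ∫⁻ a, trilinearConv F₀ (localize π r F₁ a) (localize π (2 * r) F₂ (-a)) ≤
      2 * M ^ (1 / 2 : ℝ) * (lnorm F₀ * lnorm F₁ * lnorm F₂) * V := by
    have n1 := measurable_lnorm_localize (π := π) (r := r) h1
    have n2 := (measurable_lnorm_localize (π := π) (r := 2 * r) h2).comp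
      (measurable_neg (G := EuclideanSpace ℝ (Fin 2)))
    calc _ ≤ ∫⁻ a, M ^ (1 / 2 : ℝ) * lnorm F₀ *
          (lnorm (localize π r F₁ a) * lnorm (localize π (2 * r) F₂ (-a))) := by
          refine lintegral_mono fun a => ?_
          refine (trilinearConv_le (F₁ := localize π r F₁ a)
            (F₂ := localize π (2 * r) F₂ (-a)) h0 (m1.comp measurable_prodMk_left)
            (m2.comp measurable_prodMk_left) (M := M) fun η => ?_).trans (le_of_eq (by ring))
          refine le_trans (measure_mono ?_) (hM η a)
          rintro t ⟨ht1, ht2⟩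
          unfold localize at ht1 ht2
          have := right_ne_zero_of_mul ht1
          refine ⟨?_, left_ne_zero_of_mul ht1, left_ne_zero_of_mul ht2⟩
          have := mem_of_indicator_ne_zero this
          simpa using this
      _ = M ^ (1 / 2 : ℝ) * lnorm F₀ * ∫⁻ a,
          (lnorm (localize π r F₁ a) * lnorm (localize π (2 * r) F₂ (-a))) :=
          lintegral_const_mul _ (n1.mul n2)
      _ ≤ M ^ (1 / 2 : ℝ) * lnorm F₀ * (lnorm (fun a => lnorm (localize π r F₁ a)) *
          lnorm (fun a => lnorm (localize π (2 * r) F₂ (-a)))) := by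
          gcongr
          exact lintegral_mul_le_lnorm n1 n2
      _ = _ := by
          have h4 : lnorm (fun a => lnorm (localize π (2 * r) F₂ (-a))) =
              lnorm (fun a => lnorm (localize π (2 * r) F₂ a)) := by
            unfold lnorm
            rw [lintegral_neg_eq_self
              (fun a => ((∫⁻ x, localize π (2 * r) F₂ a x ^ (2:ℝ)) ^ (1 / 2 : ℝ)) ^ (2:ℝ))]
          have h5 : (4 : ℝ≥0∞) ^ (1 / 2 : ℝ) = 2 := by
            rw [show (4 : ℝ≥0∞) = 2 ^ (2 : ℝ) by norm_num, ← ENNReal.rpow_mul]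
            norm_num
          have h6 : V ^ (1 / 2 : ℝ) * V ^ (1 / 2 : ℝ) = V := by
            rw [← ENNReal.rpow_add _ _ hV0 hVt]
            norm_num
          rw [h4, lnorm_lnorm_localize h1, lnorm_lnorm_localize h2,
            volume_closedBall_two_mul 0 0 r, ← hV,
            ENNReal.mul_rpow_of_nonneg _ _ (by norm_num), h5]
          calc _ = 2 * M ^ (1 / 2 : ℝ) * (lnorm F₀ * lnorm F₁ * lnorm F₂) *
                (V ^ (1 / 2 : ℝ) * V ^ (1 / 2 : ℝ)) := by ring
            _ = _ := by rw [h6]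
  exact (ENNReal.mul_le_mul_iff_left hV0 hVt).1 (lower.trans upper)

end TrilinearConv

/-! ### Areas of planar level sets and volumes of intersected cones. -/

section MeasureEstimates

/-- A planar set in a disc of radius `r` that meets none of its translates by `t ≥ κ` in a fixed
direction has area `O (r κ)`. -/
theorem volume_le_of_translates_disjoint {S : Set (EuclideanSpace ℝ (Fin 2))}
    (hS : MeasurableSet S) {a e : EuclideanSpace ℝ (Fin 2)} (he : ‖e‖ = 1) {r κ : ℝ} (hr : 0 < r)
    (hκ : 0 < κ) (hSr : S ⊆ Metric.closedBall a r) (ht : ∀ ξ ∈ S, ∀ t, κ ≤ t → ξ + t • e ∉ S) :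
    volume S ≤ ENNReal.ofReal (8 * Real.pi * r * κ) := by
  have hvol : ∀ ρ : ℝ, 0 ≤ ρ → volume (Metric.closedBall a ρ) = ENNReal.ofReal (Real.pi * ρ ^ 2) :=
    fun ρ hρ => by
      rw [EuclideanSpace.volume_closedBall_fin_two, ← ENNReal.ofReal_pow hρ, mul_comm,
        ENNReal.ofReal_mul Real.pi_pos.le]
  have hpi := Real.pi_pos
  rcases le_or_gt r κ with hrκ | hrκ
  · refine (measure_mono hSr).trans ?_
    rw [hvol r hr.le]
    refine ENNReal.ofReal_le_ofReal ?_
    have := mul_le_mul_of_nonneg_left hrκ (mul_pos hpi hr).le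
    have := mul_pos (mul_pos hpi hr) hκ
    nlinarith
  -- `J` translates in steps of `κ` are disjoint and stay in the disc of radius `2 r`, so `J` times
  -- the area is at most `4 π r²`.
  set J := ⌊r / κ⌋₊ with hJ
  have hJ1 : 1 ≤ J := Nat.le_floor (by rw [Nat.cast_one, le_div_iff₀ hκ]; linarith)
  have hJr : (J : ℝ) * κ ≤ r := by
    rw [← le_div_iff₀ hκ]; exact Nat.floor_le (by positivity)
  have hJr' : r ≤ 2 * J * κ := by
    have h1 : r / κ < J + 1 := Nat.lt_floor_add_one _
    rw [div_lt_iff₀ hκ] at h1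
    have : (1 : ℝ) ≤ J := by exact_mod_cast hJ1
    nlinarith
  let T : ℕ → Set (EuclideanSpace ℝ (Fin 2)) := fun j => (fun x => x - ((j : ℝ) * κ) • e) ⁻¹' S
  have hTm : ∀ j, MeasurableSet (T j) := fun j => hS.preimage (measurable_sub_const _)
  have key : ∀ i j : ℕ, i < j → Disjoint (T i) (T j) := by
    intro i j hij
    refine Set.disjoint_left.2 fun x hi hj => ?_
    refine ht _ hj (((j : ℝ) - i) * κ) ?_ ?_
    · have : (i : ℝ) + 1 ≤ j := by exact_mod_cast hij
      nlinarith
    · have : x - ((j : ℝ) * κ) • e + (((j : ℝ) - i) * κ) • e = x - ((i : ℝ) * κ) • e := by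
        module
      rw [this]
      exact hi
  have hdisj : Pairwise (fun i j => Disjoint (T i) (T j)) := fun i j hij => by
    rcases lt_or_gt_of_ne hij with h | h
    exacts [key i j h, (key j i h).symm]
  have hsub : (⋃ j ∈ Finset.range J, T j) ⊆ Metric.closedBall a (2 * r) := by
    intro x hx
    simp only [mem_iUnion, Finset.mem_range] at hx
    obtain ⟨j, hj, hx⟩ := hx
    have h1 := hSr hx
    rw [mem_closedBall_iff_norm] at h1 ⊢
    have h2 : ‖((j : ℝ) * κ) • e‖ ≤ r := by
      rw [norm_smul, he, mul_one, Real.norm_of_nonneg (by positivity)]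
      refine le_trans ?_ hJr
      gcongr
    have h3 : x - a = (x - ((j : ℝ) * κ) • e - a) + ((j : ℝ) * κ) • e := by abel
    rw [h3]
    linarith [norm_add_le (x - ((j : ℝ) * κ) • e - a) (((j : ℝ) * κ) • e)]
  have hle := measure_mono (μ := volume) hsub
  rw [measure_biUnion_finset (fun i _ j _ h => hdisj h) (fun j _ => hTm j),
    hvol _ (by positivity)] at hle
  have hT : ∀ j, volume (T j) = volume S := fun j =>
    (measurePreserving_sub_right volume _).measure_preimage hS.nullMeasurableSet
  simp only [hT, Finset.sum_const, Finset.card_range, nsmul_eq_mul] at hle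
  have hfin : volume S ≠ ⊤ := ((measure_mono hSr).trans_lt measure_closedBall_lt_top).ne
  rw [← ENNReal.ofReal_toReal hfin] at hle ⊢
  rw [← ENNReal.ofReal_natCast, ← ENNReal.ofReal_mul (by positivity),
    ENNReal.ofReal_le_ofReal_iff (by positivity)] at hle
  refine ENNReal.ofReal_le_ofReal ?_
  set v := (volume S).toReal
  have hv : 0 ≤ v := ENNReal.toReal_nonneg
  have h1 : r * v ≤ r * (8 * Real.pi * r * κ) := by
    calc r * v ≤ 2 * J * κ * v := by gcongr
      _ = 2 * κ * (J * v) := by ring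
      _ ≤ 2 * κ * (Real.pi * (2 * r) ^ 2) := by gcongr
      _ = _ := by ring
  exact le_of_mul_le_mul_left h1 hr

/-- Compactness of the circle lets finitely many fixed directions replace the varying radial one, as
translation arguments require. -/
theorem exists_finite_direction_net {δ : ℝ} (hδ : 0 < δ) :
    ∃ D : Finset (EuclideanSpace ℝ (Fin 2)), (∀ e ∈ D, ‖e‖ = 1) ∧
      ∀ ξ : EuclideanSpace ℝ (Fin 2), ∃ e ∈ D, ‖ξ - ‖ξ‖ • e‖ ≤ δ * ‖ξ‖ := by
  obtain ⟨D, hD, hfin, hcov⟩ :=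
    (isCompact_sphere (0 : EuclideanSpace ℝ (Fin 2)) 1).finite_cover_balls hδ
  lift D to Finset (EuclideanSpace ℝ (Fin 2)) using hfin
  have hnet : ∀ ω : EuclideanSpace ℝ (Fin 2), ‖ω‖ = 1 → ∃ e ∈ D, ‖ω - e‖ ≤ δ := by
    intro ω hω
    have := hcov (mem_sphere_zero_iff_norm.2 hω)
    simp only [mem_iUnion] at this
    obtain ⟨e, he, h⟩ := this
    exact ⟨e, he, (mem_ball_iff_norm.1 h).le⟩
  refine ⟨D, fun e he => mem_sphere_zero_iff_norm.1 (hD he), fun ξ => ?_⟩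
  rcases eq_or_ne ξ 0 with rfl | hξ
  · obtain ⟨e, he, -⟩ := hnet (EuclideanSpace.single 0 1) (by simp)
    exact ⟨e, he, by simp⟩
  have hn : 0 < ‖ξ‖ := norm_pos_iff.2 hξ
  obtain ⟨e, he, h⟩ := hnet (‖ξ‖⁻¹ • ξ) (by rw [norm_smul, norm_inv, norm_norm]; field_simp)
  refine ⟨e, he, ?_⟩
  have : ξ - ‖ξ‖ • e = ‖ξ‖ • (‖ξ‖⁻¹ • ξ - e) := by
    rw [smul_sub, smul_smul, mul_inv_cancel₀ hn.ne', one_smul]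
  rw [this, norm_smul, norm_norm, mul_comm]
  gcongr

/-- Apply the triangle inequality to `‖ξ‖ (ξ + t e) = (‖ξ‖ + t) ξ - t (ξ - ‖ξ‖ e)`. -/
theorem norm_add_smul_ge {ξ e : EuclideanSpace ℝ (Fin 2)} (he : ‖e‖ = 1) {δ t : ℝ} (hδ : 0 ≤ δ)
    (ht : 0 ≤ t) (h : ‖ξ - ‖ξ‖ • e‖ ≤ δ * ‖ξ‖) : ‖ξ‖ + t * (1 - δ) ≤ ‖ξ + t • e‖ := by
  rcases eq_or_ne ξ 0 with rfl | hξ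
  · simp only [norm_zero, zero_add, norm_smul, he, Real.norm_of_nonneg ht]
    nlinarith
  have hn : 0 < ‖ξ‖ := norm_pos_iff.2 hξ
  refine le_of_mul_le_mul_left ?_ hn
  have h1 : ‖ξ‖ * ‖ξ + t • e‖ = ‖(‖ξ‖ + t) • ξ - t • (ξ - ‖ξ‖ • e)‖ := by
    rw [← norm_norm ξ, ← norm_smul, norm_norm]
    congr 1
    module
  have h2 := norm_sub_norm_le ((‖ξ‖ + t) • ξ) (t • (ξ - ‖ξ‖ • e))
  rw [norm_smul, norm_smul, Real.norm_of_nonneg ht, Real.norm_of_nonneg (by positivity)] at h2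
  rw [h1]
  have := mul_le_mul_of_nonneg_left h ht
  nlinarith

/-- The level sets of `‖ξ‖ + m ‖ξ' - ξ‖`, `|m| < 1`, are transversal to the radial direction. -/
theorem exists_volume_transversal_le {c : ℝ} (hc : c < 1) :
    ∃ C : ℝ, 0 ≤ C ∧ ∀ (m : ℝ), |m| ≤ c → ∀ (a ξ' : EuclideanSpace ℝ (Fin 2)) (u r h : ℝ), 0 < r →
      0 < h → volume {ξ | ‖ξ - a‖ ≤ r ∧ |‖ξ‖ + m * ‖ξ' - ξ‖ - u| ≤ h} ≤
        ENNReal.ofReal (C * (r * h)) := by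
  -- With this `δ`, a step `t` along `e` raises `‖ξ‖` by at least `t (1 + c) / 2` and changes the
  -- other term by at most `c t`. The net gain `t (1 - c) / 2` exceeds `2 h` once `t ≥ 5 h / (1 -
  -- c)`.
  have hδ : 0 < (1 - c) / 2 := by linarith
  obtain ⟨D, hD1, hD⟩ := exists_finite_direction_net hδ
  refine ⟨D.card * (8 * Real.pi * (5 / (1 - c))), by
    have : 0 < 1 - c := by linarith
    positivity, fun m hm a ξ' u r h hr hh => ?_⟩
  set S := {ξ : EuclideanSpace ℝ (Fin 2) | ‖ξ - a‖ ≤ r ∧ |‖ξ‖ + m * ‖ξ' - ξ‖ - u| ≤ h} with hS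
  have hcov : S ⊆ ⋃ e ∈ D, S ∩ {ξ | ‖ξ - ‖ξ‖ • e‖ ≤ (1 - c) / 2 * ‖ξ‖} := by
    intro ξ hξ
    obtain ⟨e, he, h⟩ := hD ξ
    simp only [mem_iUnion]
    exact ⟨e, he, hξ, h⟩
  have hSc : IsClosed S := by
    rw [hS, ofPred_and]
    exact (isClosed_le (by fun_prop) (by fun_prop)).inter (isClosed_le (by fun_prop) (by fun_prop))
  refine (measure_mono hcov).trans ((measure_biUnion_finset_le _ _).trans ?_)
  have each : ∀ e ∈ D, volume (S ∩ {ξ | ‖ξ - ‖ξ‖ • e‖ ≤ (1 - c) / 2 * ‖ξ‖}) ≤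
      ENNReal.ofReal (8 * Real.pi * r * (5 * h / (1 - c))) := by
    intro e he
    refine volume_le_of_translates_disjoint (a := a)
      ((hSc.inter (isClosed_le (by fun_prop) (by fun_prop))).measurableSet) (hD1 e he) hr
      (by have : 0 < 1 - c := by linarith
          positivity) ?_ ?_
    · intro ξ hξ
      exact mem_closedBall_iff_norm.2 hξ.1.1
    · rintro ξ ⟨⟨-, h1⟩, h2⟩ t ht ⟨⟨-, h3⟩, -⟩
      have hc' : 0 < 1 - c := by linarith
      rw [div_le_iff₀ hc'] at ht
      have ht0 : 0 < t := by
        by_contra hneg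
        nlinarith
      have h4 := norm_add_smul_ge (hD1 e he) hδ.le ht0.le h2
      have h5 : |‖ξ' - (ξ + t • e)‖ - ‖ξ' - ξ‖| ≤ t := by
        refine (abs_norm_sub_norm_le _ _).trans ?_
        have : ξ' - (ξ + t • e) - (ξ' - ξ) = -(t • e) := by abel
        rw [this, norm_neg, norm_smul, hD1 e he, Real.norm_of_nonneg ht0.le, mul_one]
      have h6 : |m * (‖ξ' - (ξ + t • e)‖ - ‖ξ' - ξ‖)| ≤ c * t := by
        rw [abs_mul]
        exact mul_le_mul hm h5 (abs_nonneg _) ((abs_nonneg m).trans hm)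
      rw [abs_le] at h1 h3 h6
      nlinarith
  refine (Finset.sum_le_sum each).trans ?_
  rw [Finset.sum_const, nsmul_eq_mul, ← ENNReal.ofReal_natCast,
    ← ENNReal.ofReal_mul (by positivity)]
  refine ENNReal.ofReal_le_ofReal (le_of_eq ?_)
  ring

theorem exists_unit_inner_eq_zero (ξ' : EuclideanSpace ℝ (Fin 2)) :
    ∃ e : EuclideanSpace ℝ (Fin 2), ‖e‖ = 1 ∧ inner ℝ e ξ' = 0 := by
  have h : ∃ v : EuclideanSpace ℝ (Fin 2), v ≠ 0 ∧ inner ℝ v ξ' = 0 := by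
    rcases eq_or_ne ξ' 0 with rfl | hξ
    · exact ⟨EuclideanSpace.single 0 1, by simp, by simp⟩
    · refine ⟨!₂[-ξ' 1, ξ' 0], fun h0 => hξ ?_, ?_⟩
      · have h1 := congrFun (congrArg WithLp.ofLp h0) 0
        have h2 := congrFun (congrArg WithLp.ofLp h0) 1
        simp at h1 h2
        ext i
        fin_cases i <;> simp [h1, h2]
      · simp [PiLp.inner_apply, Fin.sum_univ_two]
        ring
  obtain ⟨v, hv, hi⟩ := h
  refine ⟨‖v‖⁻¹ • v, ?_, ?_⟩
  · rw [norm_smul, norm_inv, norm_norm]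
    have := norm_pos_iff.2 hv
    field_simp
  · rw [real_inner_smul_left, hi, mul_zero]

/-- Moving outwards perpendicular to the focal axis increases the distances to both foci `0` and
`ξ'`, and a step of length `3 √(R h)` already leaves the thickened ellipse. -/
theorem volume_halfEllipse_le {e ξ' : EuclideanSpace ℝ (Fin 2)} (he : ‖e‖ = 1)
    (hi : inner ℝ e ξ' = 0) {u R h : ℝ} (hR : 0 < R) (hh : 0 < h) :
    volume {ξ | (‖ξ‖ ≤ R ∧ |‖ξ‖ + ‖ξ' - ξ‖ - u| ≤ h) ∧ 0 ≤ inner ℝ e ξ} ≤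
      ENNReal.ofReal (8 * Real.pi * R * (3 * √(R * h))) := by
  refine volume_le_of_translates_disjoint (a := 0) (IsClosed.measurableSet ?_) he hR
    (by positivity) ?_ ?_
  · simp only [ofPred_and]
    exact ((isClosed_le (by fun_prop) (by fun_prop)).inter
      (isClosed_le (by fun_prop) (by fun_prop))).inter (isClosed_le (by fun_prop) (by fun_prop))
  · intro ξ hξ
    exact mem_closedBall_zero_iff.2 hξ.1.1
  · rintro ξ ⟨⟨h1, h2⟩, h3⟩ t ht ⟨⟨h4, h5⟩, -⟩
    have hs : 0 < √(R * h) := by positivity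
    have ht0 : 0 < t := by linarith
    have hsq : √(R * h) ^ 2 = R * h := Real.sq_sqrt (by positivity)
    have ht2 : 9 * (R * h) ≤ t ^ 2 := by nlinarith
    have e1 : ‖ξ + t • e‖ ^ 2 = ‖ξ‖ ^ 2 + 2 * (t * inner ℝ e ξ) + t ^ 2 := by
      rw [norm_add_sq_real, real_inner_smul_right, real_inner_comm, norm_smul, he,
        Real.norm_of_nonneg ht0.le, mul_one]
    have e2 : ‖ξ' - (ξ + t • e)‖ ^ 2 = ‖ξ' - ξ‖ ^ 2 + 2 * (t * inner ℝ e ξ) + t ^ 2 := by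
      have : ξ' - (ξ + t • e) = (ξ' - ξ) - t • e := by abel
      rw [this, norm_sub_sq_real, real_inner_smul_right, real_inner_comm, inner_sub_right, hi,
        norm_smul, he, Real.norm_of_nonneg ht0.le, mul_one]
      ring
    have hte : 0 ≤ t * inner ℝ e ξ := by positivity
    have m2 : ‖ξ' - ξ‖ ≤ ‖ξ' - (ξ + t • e)‖ := by
      refine le_of_sq_le_sq ?_ (norm_nonneg _)
      nlinarith
    -- The squares differ by at least `9 R h`, while the two norms sum to at most `2 R`.
    have m1 : ‖ξ‖ + 3 * h ≤ ‖ξ + t • e‖ := by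
      have h0 := norm_nonneg ξ
      have h0' := norm_nonneg (ξ + t • e)
      by_contra hlt
      push Not at hlt
      nlinarith
    rw [abs_le] at h2 h5
    linarith

/-- The area between two ellipses with the same foci. -/
theorem volume_ellipse_le (ξ' : EuclideanSpace ℝ (Fin 2)) {u R h : ℝ} (hR : 0 < R) (hh : 0 < h) :
    volume {ξ | ‖ξ‖ ≤ R ∧ |‖ξ‖ + ‖ξ' - ξ‖ - u| ≤ h} ≤
      ENNReal.ofReal (48 * Real.pi * R * √(R * h)) := by
  obtain ⟨e, he, hi⟩ := exists_unit_inner_eq_zero ξ'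
  have h1 := volume_halfEllipse_le he hi (u := u) hR hh
  have h2 := volume_halfEllipse_le (e := -e) (by rwa [norm_neg]) (by rw [inner_neg_left, hi, neg_zero])
    (u := u) hR hh
  have hsub : {ξ : EuclideanSpace ℝ (Fin 2) | ‖ξ‖ ≤ R ∧ |‖ξ‖ + ‖ξ' - ξ‖ - u| ≤ h} ⊆
      {ξ | (‖ξ‖ ≤ R ∧ |‖ξ‖ + ‖ξ' - ξ‖ - u| ≤ h) ∧ 0 ≤ inner ℝ e ξ} ∪
      {ξ | (‖ξ‖ ≤ R ∧ |‖ξ‖ + ‖ξ' - ξ‖ - u| ≤ h) ∧ 0 ≤ inner ℝ (-e) ξ} := by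
    intro ξ hξ
    rcases le_total 0 (inner ℝ e ξ) with h | h
    · exact Or.inl ⟨hξ, h⟩
    · exact Or.inr ⟨hξ, by rw [inner_neg_left]; linarith⟩
  refine (measure_mono hsub).trans ((measure_union_le _ _).trans ((add_le_add h1 h2).trans ?_))
  rw [← ENNReal.ofReal_add (by positivity) (by positivity)]
  exact ENNReal.ofReal_le_ofReal (le_of_eq (by ring))

theorem continuous_spatialPart : Continuous spatialPart := by
  unfold spatialPart
  fun_prop

/-- Splitting of space-time into time and space. -/
theorem measurePreserving_time_spatialPart :
    MeasurePreserving (fun p : SpaceTime => (p 0, spatialPart p)) volume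
      ((volume : Measure ℝ).prod volume) := by
  have h1 := EuclideanSpace.volume_preserving_symm_measurableEquiv_toLp (Fin 3)
  have h2 := volume_preserving_piFinSuccAbove (fun _ : Fin 3 => ℝ) 0
  have h3 := (MeasurePreserving.id (volume : Measure ℝ)).prod
    (EuclideanSpace.volume_preserving_symm_measurableEquiv_toLp (Fin 2)).symm
  have h4 := h3.comp (h2.comp h1)
  refine MeasurePreserving.congr h4
    (Continuous.measurable (.prodMk (by fun_prop) continuous_spatialPart)) (ae_of_all _ fun p => Prod.ext rfl ?_)
  ext i
  fin_cases i <;> rfl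

/-- Fubini: every time fibre over `S` is contained in an interval of length `2 l`. -/
theorem volume_slab_le {S : Set (EuclideanSpace ℝ (Fin 2))} (hS : MeasurableSet S)
    {ψ : EuclideanSpace ℝ (Fin 2) → ℝ} (hψ : Measurable ψ) (l : ℝ) :
    volume {p : SpaceTime | spatialPart p ∈ S ∧ |p 0 - ψ (spatialPart p)| ≤ l} ≤
      volume S * ENNReal.ofReal (2 * l) := by
  set W : Set (ℝ × EuclideanSpace ℝ (Fin 2)) := {q | q.2 ∈ S ∧ |q.1 - ψ q.2| ≤ l} with hW
  have hWm : MeasurableSet W := by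
    rw [hW, ofPred_and]
    exact (measurable_snd hS).inter (measurableSet_le (by fun_prop) (by fun_prop))
  have h := measurePreserving_time_spatialPart.measure_preimage hWm.nullMeasurableSet
  have e : (fun p : SpaceTime => (p 0, spatialPart p)) ⁻¹' W =
    {p : SpaceTime | spatialPart p ∈ S ∧ |p 0 - ψ (spatialPart p)| ≤ l} := rfl
  rw [e] at h
  rw [h, Measure.prod_apply_symm hWm]
  have : ∀ ξ, volume ((fun x => (x, ξ)) ⁻¹' W) ≤ S.indicator (fun _ => ENNReal.ofReal (2 * l)) ξ := by
    intro ξ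
    by_cases hξ : ξ ∈ S
    · rw [indicator_of_mem hξ, ← Real.volume_closedBall (ψ ξ)]
      refine measure_mono fun x hx => ?_
      exact mem_closedBall_iff_norm.2 hx.2
    · rw [indicator_of_notMem hξ]
      refine le_of_eq (measure_mono_null (t := ∅) (fun x hx => hξ hx.1) measure_empty)
  refine (lintegral_mono this).trans (le_of_eq ?_)
  rw [lintegral_indicator hS, setLIntegral_const, mul_comm]

theorem spatialPart_sub (p q : SpaceTime) :
    spatialPart (p - q) = spatialPart p - spatialPart q := by
  ext i
  fin_cases i <;> rfl

/-- The planar area carries the larger modulation and the time fibre can be given the smaller one;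
their product is `L₀ L₁`. -/
theorem le_ofReal_of_le_mul_of_le_mul {v x : ℝ≥0∞} {D L₀ L₁ : ℝ} (h0 : 0 < L₀) (h1 : 0 < L₁)
    (hD : 0 ≤ D) (hv0 : v ≤ x * ENNReal.ofReal (4 * L₀)) (hv1 : v ≤ x * ENNReal.ofReal (4 * L₁))
    (hx : x ≤ ENNReal.ofReal (D * max L₀ L₁)) : v ≤ ENNReal.ofReal (4 * D * (L₀ * L₁)) := by
  rcases le_total L₀ L₁ with h | h
  · refine hv0.trans ((mul_le_mul_left hx _).trans ?_)
    rw [max_eq_right h, ← ENNReal.ofReal_mul (by positivity)]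
    exact ENNReal.ofReal_le_ofReal (le_of_eq (by ring))
  · refine hv1.trans ((mul_le_mul_left hx _).trans ?_)
    rw [max_eq_left h, ← ENNReal.ofReal_mul (by positivity)]
    exact ENNReal.ofReal_le_ofReal (le_of_eq (by ring))

/-- Intersection of thickened cones of speeds `1` and `c < 1` over a disc. -/
theorem exists_volume_cones_transversal_le {c : ℝ} (hc0 : 0 < c) (hc : c < 1) :
    ∃ C : ℝ, 0 ≤ C ∧ ∀ (ε : ℤˣ) (ζ : SpaceTime) (a : EuclideanSpace ℝ (Fin 2)) (r L₀ L₁ : ℝ),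
      0 < r → 0 < L₀ → 0 < L₁ →
      volume {p : SpaceTime | ‖spatialPart p - a‖ ≤ r ∧ |p 0 - ‖spatialPart p‖| ≤ 2 * L₁ ∧
        |(ζ - p) 0 + ((ε : ℤ) : ℝ) * (c * ‖spatialPart (ζ - p)‖)| ≤ 2 * L₀} ≤
          ENNReal.ofReal (C * (r * (L₀ * L₁))) := by
  obtain ⟨C, hC, h⟩ := exists_volume_transversal_le hc
  refine ⟨16 * C, by positivity, fun ε ζ a r L₀ L₁ hr h0 h1 => ?_⟩
  have hε : |((ε : ℤ) : ℝ)| = 1 := by rcases Int.units_eq_one_or ε with rfl | rfl <;> simp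
  have hS := h (-((ε : ℤ) : ℝ) * c) (by rw [abs_mul, abs_neg, hε, one_mul, abs_of_pos hc0]) a
    (spatialPart ζ) (ζ 0) r (2 * (L₀ + L₁)) hr (by positivity)
  set S := {ξ | ‖ξ - a‖ ≤ r ∧ |‖ξ‖ + -((ε : ℤ) : ℝ) * c * ‖spatialPart ζ - ξ‖ - ζ 0| ≤
    2 * (L₀ + L₁)} with hSd
  have hSm : MeasurableSet S := by
    refine IsClosed.measurableSet ?_
    rw [hSd, ofPred_and]
    exact (isClosed_le (by fun_prop) (by fun_prop)).inter (isClosed_le (by fun_prop) (by fun_prop))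
  -- Eliminating `τ` between the two modulation conditions leaves a planar level set of
  -- half-thickness `2 (L₀ + L₁)`.
  have hmem : ∀ p : SpaceTime, (‖spatialPart p - a‖ ≤ r ∧ |p 0 - ‖spatialPart p‖| ≤ 2 * L₁ ∧
        |(ζ - p) 0 + ((ε : ℤ) : ℝ) * (c * ‖spatialPart (ζ - p)‖)| ≤ 2 * L₀) →
        spatialPart p ∈ S ∧
          |p 0 - (ζ 0 + ((ε : ℤ) : ℝ) * (c * ‖spatialPart ζ - spatialPart p‖))| ≤ 2 * L₀ := by
    rintro p ⟨h2, h3, h4⟩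
    rw [spatialPart_sub, PiLp.sub_apply] at h4
    refine ⟨⟨h2, ?_⟩, ?_⟩
    · rw [abs_le] at h3 h4 ⊢
      constructor <;> linarith
    · rw [abs_le] at h4 ⊢
      constructor <;> linarith
  have v0 := volume_slab_le hSm (ψ := fun ξ => ζ 0 + ((ε : ℤ) : ℝ) * (c * ‖spatialPart ζ - ξ‖))
    (by fun_prop) (2 * L₀)
  have v1 := volume_slab_le hSm (ψ := fun ξ => ‖ξ‖) (by fun_prop) (2 * L₁)
  rw [← mul_assoc, show (2 : ℝ) * 2 = 4 by norm_num] at v0 v1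
  refine (le_ofReal_of_le_mul_of_le_mul (D := C * r * 4) h0 h1 (by positivity)
    ((measure_mono fun p hp => hmem p hp).trans v0)
    (le_trans (measure_mono fun p hp => And.intro (hmem p hp).1 hp.2.1) v1)
    (hS.trans (ENNReal.ofReal_le_ofReal ?_))).trans (ENNReal.ofReal_le_ofReal (le_of_eq (by ring)))
  have : L₀ + L₁ ≤ 2 * max L₀ L₁ := by linarith [le_max_left L₀ L₁, le_max_right L₀ L₁]
  calc C * (r * (2 * (L₀ + L₁))) ≤ C * (r * (2 * (2 * max L₀ L₁))) := by gcongr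
    _ = _ := by ring

/-- Intersection of two thickened cones of speed `1` over the disc of radius `R`. -/
theorem volume_cones_le (ζ : SpaceTime) {R L₁ L₂ : ℝ} (hR : 0 < R) (h1 : 1 ≤ L₁) (h2 : 1 ≤ L₂) :
    volume {p : SpaceTime | ‖spatialPart p‖ ≤ R ∧ |p 0 - ‖spatialPart p‖| ≤ 2 * L₁ ∧
        |(ζ - p) 0 - ‖spatialPart (ζ - p)‖| ≤ 2 * L₂} ≤
      ENNReal.ofReal (384 * Real.pi * (R * √R * (L₁ * L₂))) := by
  have hS := volume_ellipse_le (spatialPart ζ) (u := ζ 0) hR (h := 2 * (L₁ + L₂)) (by positivity)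
  set S := {ξ | ‖ξ‖ ≤ R ∧ |‖ξ‖ + ‖spatialPart ζ - ξ‖ - ζ 0| ≤ 2 * (L₁ + L₂)} with hSd
  have hSm : MeasurableSet S := by
    refine IsClosed.measurableSet ?_
    rw [hSd, ofPred_and]
    exact (isClosed_le (by fun_prop) (by fun_prop)).inter (isClosed_le (by fun_prop) (by fun_prop))
  have hmem : ∀ p : SpaceTime, (‖spatialPart p‖ ≤ R ∧ |p 0 - ‖spatialPart p‖| ≤ 2 * L₁ ∧
        |(ζ - p) 0 - ‖spatialPart (ζ - p)‖| ≤ 2 * L₂) →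
        spatialPart p ∈ S ∧ |p 0 - (ζ 0 - ‖spatialPart ζ - spatialPart p‖)| ≤ 2 * L₂ := by
    rintro p ⟨h2, h3, h4⟩
    rw [spatialPart_sub, PiLp.sub_apply] at h4
    refine ⟨⟨h2, ?_⟩, ?_⟩
    · rw [abs_le] at h3 h4 ⊢
      constructor <;> linarith
    · rw [abs_le] at h4 ⊢
      constructor <;> linarith
  have v2 := volume_slab_le hSm (ψ := fun ξ => ζ 0 - ‖spatialPart ζ - ξ‖) (by fun_prop) (2 * L₂)
  have v1 := volume_slab_le hSm (ψ := fun ξ => ‖ξ‖) (by fun_prop) (2 * L₁)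
  rw [← mul_assoc, show (2 : ℝ) * 2 = 4 by norm_num] at v1 v2
  refine (le_ofReal_of_le_mul_of_le_mul (D := 96 * Real.pi * R * √R) (by positivity) (by positivity)
    (by positivity) (le_trans (measure_mono fun p hp => And.intro (hmem p hp).1 hp.2.1) v1)
    ((measure_mono fun p hp => hmem p hp).trans v2)
    (hS.trans (ENNReal.ofReal_le_ofReal ?_))).trans (ENNReal.ofReal_le_ofReal (le_of_eq (by ring)))
  -- As modulations are at least `1`, the square root of the larger one may be replaced by the
  -- modulation itself, which gives the same product form as in the transversal case.
  have hm : 1 ≤ max L₁ L₂ := h1.trans (le_max_left _ _)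
  have h3 : √(R * (2 * (L₁ + L₂))) ≤ √R * (2 * max L₁ L₂) := by
    rw [Real.sqrt_mul hR.le]
    gcongr
    refine Real.sqrt_le_iff.2 ⟨by positivity, ?_⟩
    nlinarith [le_max_left L₁ L₂, le_max_right L₁ L₂]
  calc 48 * Real.pi * R * √(R * (2 * (L₁ + L₂)))
      ≤ 48 * Real.pi * R * (√R * (2 * max L₁ L₂)) := by gcongr
    _ = _ := by ring

end MeasureEstimates

/-! ### Dyadic regions and the absence of resonance. -/

section DyadicPieces

theorem abs_le_japaneseBracket (x : ℝ) : |x| ≤ japaneseBracket x :=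
  Real.abs_le_sqrt (by linarith)

theorem japaneseBracket_le (x : ℝ) : japaneseBracket x ≤ 1 + |x| := by
  refine Real.sqrt_le_iff.2 ⟨by positivity, ?_⟩
  nlinarith [sq_abs x, abs_nonneg x]

theorem measurableSet_dyadicRegion (ε : ℤˣ) (c N L : ℝ) : MeasurableSet (dyadicRegion ε c N L) := by
  have hs := continuous_spatialPart
  have h1 : Continuous fun p : SpaceTime => japaneseBracket ‖spatialPart p‖ := by
    unfold japaneseBracket; fun_prop
  have h2 : Continuous fun p : SpaceTime =>
      japaneseBracket (p 0 + ((ε : ℤ) : ℝ) * (c * ‖spatialPart p‖)) := by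
    unfold japaneseBracket; fun_prop
  refine IsClosed.measurableSet ?_
  unfold dyadicRegion
  simp only [ofPred_and]
  exact ((isClosed_le (by fun_prop) h1).inter (isClosed_le h1 (by fun_prop))).inter
    ((isClosed_le (by fun_prop) h2).inter (isClosed_le h2 (by fun_prop)))

section Region

variable {ε : ℤˣ} {c N L : ℝ} {p : SpaceTime}

theorem norm_spatialPart_le_of_mem (h : p ∈ dyadicRegion ε c N L) : ‖spatialPart p‖ ≤ 2 * N :=
  ((le_abs_self _).trans (abs_le_japaneseBracket _)).trans h.1.2

theorem le_one_add_norm_spatialPart_of_mem (h : p ∈ dyadicRegion ε c N L) :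
    N ≤ 1 + ‖spatialPart p‖ := by
  have := h.1.1.trans (japaneseBracket_le _)
  rwa [abs_norm] at this

theorem abs_modulation_le_of_mem (h : p ∈ dyadicRegion ε c N L) :
    |p 0 + ((ε : ℤ) : ℝ) * (c * ‖spatialPart p‖)| ≤ 2 * L :=
  (abs_le_japaneseBracket _).trans h.2.2

theorem abs_modulation_le_of_mem_neg (h : p ∈ dyadicRegion (-1) 1 N L) :
    |p 0 - ‖spatialPart p‖| ≤ 2 * L := by
  have := abs_modulation_le_of_mem h
  simpa [sub_eq_add_neg] using this

end Region

/-- Two waves on the forward cone never resonate with a slower wave. -/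
theorem le_of_mem_dyadicRegion {c : ℝ} (hc0 : 0 < c) (hc : c < 1) {ε : ℤˣ}
    {N₀ N₁ N₂ L₀ L₁ L₂ m : ℝ} {p₀ p₁ p₂ : SpaceTime} (h0 : p₀ ∈ dyadicRegion ε c N₀ L₀)
    (h1 : p₁ ∈ dyadicRegion (-1) 1 N₁ L₁) (h2 : p₂ ∈ dyadicRegion (-1) 1 N₂ L₂)
    (hp : p₀ + p₁ + p₂ = 0) (hm : 1 ≤ m) (hm0 : L₀ ≤ m) (hm1 : L₁ ≤ m) (hm2 : L₂ ≤ m) :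
    N₀ ≤ 7 / (1 - c) * m ∧ N₁ ≤ 7 / (1 - c) * m ∧ N₂ ≤ 7 / (1 - c) * m := by
  have hc' : 0 < 1 - c := by linarith
  have e0 : p₀ = 0 - p₁ - p₂ := by rw [eq_sub_iff_add_eq, eq_sub_iff_add_eq, ← hp]; abel
  have n0 : ‖spatialPart p₀‖ ≤ ‖spatialPart p₁‖ + ‖spatialPart p₂‖ := by
    have z : spatialPart (0 : SpaceTime) = 0 := by ext i; fin_cases i <;> rfl
    rw [e0, spatialPart_sub, spatialPart_sub, z, zero_sub]
    exact (norm_sub_le _ _).trans (by rw [norm_neg])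
  have t0 : p₀ 0 = - p₁ 0 - p₂ 0 := by rw [e0]; simp
  have a0 := abs_modulation_le_of_mem h0
  have a1 := abs_modulation_le_of_mem_neg h1
  have a2 := abs_modulation_le_of_mem_neg h2
  rw [abs_le] at a0 a1 a2
  have hsig : -(c * ‖spatialPart p₀‖) ≤ ((ε : ℤ) : ℝ) * (c * ‖spatialPart p₀‖) ∧
      ((ε : ℤ) : ℝ) * (c * ‖spatialPart p₀‖) ≤ c * ‖spatialPart p₀‖ := by
    have : 0 ≤ c * ‖spatialPart p₀‖ := by positivity
    rcases Int.units_eq_one_or ε with rfl | rfl <;> simp <;> linarith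
  have hcn := mul_le_mul_of_nonneg_left n0 hc0.le
  -- Here `|ξ₁| + |ξ₂| ≤ τ₁ + τ₂ + 4 m = -τ₀ + 4 m ≤ c |ξ₀| + 6 m`. The `7` in the conclusion
  -- absorbs the `1` in `N ≤ 1 + |ξ|`.
  have key : (1 - c) * (‖spatialPart p₁‖ + ‖spatialPart p₂‖) ≤ 6 * m := by linarith [hsig.1, hsig.2]
  have main : ∀ N, N ≤ 1 + (‖spatialPart p₁‖ + ‖spatialPart p₂‖) → N ≤ 7 / (1 - c) * m := by
    intro N hN
    rw [div_mul_eq_mul_div, le_div_iff₀ hc']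
    have := mul_le_mul_of_nonneg_left hN hc'.le
    nlinarith
  have q0 := le_one_add_norm_spatialPart_of_mem h0
  have q1 := le_one_add_norm_spatialPart_of_mem h1
  have q2 := le_one_add_norm_spatialPart_of_mem h2
  have p1 := norm_nonneg (spatialPart p₁)
  have p2 := norm_nonneg (spatialPart p₂)
  exact ⟨main _ (by linarith), main _ (by linarith), main _ (by linarith)⟩

/-- `η ↦ ξ` for `(τ, ξ) = 2 π η`. -/
noncomputable def scaledSpatialPart : SpaceTime →L[ℝ] EuclideanSpace ℝ (Fin 2) :=
  LinearMap.toContinuousLinearMap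
    { toFun := fun η => spatialPart ((2 * Real.pi) • η)
      map_add' := fun x y => by
        ext i
        fin_cases i <;> simp [spatialPart]
      map_smul' := fun a x => by
        ext i
        fin_cases i <;> simp [spatialPart, mul_left_comm] }

theorem scaledSpatialPart_apply (η : SpaceTime) :
    scaledSpatialPart η = spatialPart ((2 * Real.pi) • η) := rfl

theorem volume_preimage_two_pi_smul_le (s : Set SpaceTime) :
    volume ((fun η : SpaceTime => (2 * Real.pi) • η) ⁻¹' s) ≤ volume s := by
  have h2 : 1 ≤ 2 * Real.pi := by linarith [Real.pi_gt_three]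
  rw [Measure.addHaar_preimage_smul volume (by positivity)]
  refine mul_le_of_le_one_left' ?_
  rw [← ENNReal.ofReal_one]
  refine ENNReal.ofReal_le_ofReal ?_
  rw [abs_of_nonneg (by positivity)]
  exact inv_le_one_of_one_le₀ (one_le_pow₀ h2)

theorem two_rpow_mul_two_rpow (x y : ℝ) : (2 : ℝ≥0∞) ^ x * 2 ^ y = 2 ^ (x + y) :=
  (ENNReal.rpow_add _ _ two_ne_zero ENNReal.ofNat_ne_top).symm

theorem ofReal_mul_two_rpow_rpow_half {D : ℝ} (hD : 0 ≤ D) (x : ℝ) :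
    ENNReal.ofReal (D * 2 ^ x) ^ (1 / 2 : ℝ) = (NNReal.sqrt D.toNNReal : ℝ≥0) * 2 ^ (x / 2) := by
  rw [ENNReal.ofReal_mul hD, ENNReal.mul_rpow_of_nonneg _ _ (by norm_num),
    ← ENNReal.ofReal_rpow_of_pos two_pos, ENNReal.ofReal_ofNat, ← ENNReal.rpow_mul,
    NNReal.sqrt_eq_rpow, ENNReal.coe_rpow_of_nonneg _ (by norm_num)]
  congr 2
  ring

/-! ### Trilinear bounds for functions supported on dyadic regions. -/

section Trilinear

/-- `F` lives, in the variable `2 π η`, on `K`. -/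
def SupportedOn (F : SpaceTime → ℝ≥0∞) (K : Set SpaceTime) : Prop :=
  ∀ η, F η ≠ 0 → (2 * Real.pi) • η ∈ K

variable {F₀ F₁ F₂ : SpaceTime → ℝ≥0∞}

/-- With `F₂` outermost, Cauchy–Schwarz meets cones of speeds `c` and `1`. The disc in the volume
bound comes from the support of `F₁` when `k = k₁`, and from localization by the support of `F₂`
when `k = k₂`. -/
theorem exists_trilinearConv_transversal_le {c : ℝ} (hc0 : 0 < c) (hc : c < 1) :
    ∃ C : ℝ≥0, ∀ {F₀ F₁ F₂ : SpaceTime → ℝ≥0∞} {ε : ℤˣ} {k₁ k₂ l₀ l₁ : ℕ} {N₀ L₂ : ℝ},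
      Measurable F₀ → Measurable F₁ → Measurable F₂ →
      SupportedOn F₀ (dyadicRegion ε c N₀ (2 ^ l₀)) →
      SupportedOn F₁ (dyadicRegion (-1) 1 (2 ^ k₁) (2 ^ l₁)) →
      SupportedOn F₂ (dyadicRegion (-1) 1 (2 ^ k₂) L₂) → ∀ k, k = k₁ ∨ k = k₂ →
      trilinearConv F₀ F₁ F₂ ≤ C * 2 ^ (((k : ℝ) + l₀ + l₁) / 2) *
        (lnorm F₀ * lnorm F₁ * lnorm F₂) := by
  obtain ⟨C, hC, hvol⟩ := exists_volume_cones_transversal_le hc0 hc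
  refine ⟨2 * NNReal.sqrt (C * 2).toNNReal, ?_⟩
  intro F₀ F₁ F₂ ε k₁ k₂ l₀ l₁ N₀ L₂ m0 m1 m2 s0 s1 s2 k hk
  set M := ENNReal.ofReal (C * (2 * 2 ^ k * (2 ^ l₀ * 2 ^ l₁))) with hM
  have hMs : M ^ (1 / 2 : ℝ) =
      (NNReal.sqrt (C * 2).toNNReal : ℝ≥0) * 2 ^ (((k : ℝ) + l₀ + l₁) / 2) := by
    rw [← ofReal_mul_two_rpow_rpow_half (by positivity), hM, Real.rpow_add two_pos,
      Real.rpow_add two_pos, Real.rpow_natCast, Real.rpow_natCast, Real.rpow_natCast]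
    congr 2
    ring
  have hvol' : ∀ η a, volume {t | ‖scaledSpatialPart t - a‖ ≤ 2 * 2 ^ k ∧ F₁ t ≠ 0 ∧
      F₀ (η - t) ≠ 0} ≤ M := by
    intro η a
    refine le_trans (le_trans (measure_mono ?_) (volume_preimage_two_pi_smul_le _))
      (hvol ε ((2 * Real.pi) • η) a (2 * 2 ^ k) (2 ^ l₀) (2 ^ l₁) (by positivity) (by positivity)
        (by positivity))
    rintro t ⟨ht, ht1, ht0⟩
    refine ⟨ht, abs_modulation_le_of_mem_neg (s1 _ ht1), ?_⟩
    have := abs_modulation_le_of_mem (s0 _ ht0)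
    rwa [smul_sub] at this
  rw [trilinearConv_swap_outer m0 m1 m2]
  have hout : 2 * M ^ (1 / 2 : ℝ) * (lnorm F₂ * lnorm F₁ * lnorm F₀) =
      ((2 * NNReal.sqrt (C * 2).toNNReal : ℝ≥0) : ℝ≥0∞) * 2 ^ (((k : ℝ) + l₀ + l₁) / 2) *
        (lnorm F₀ * lnorm F₁ * lnorm F₂) := by
    rw [hMs]
    push_cast
    ring
  rw [← hout]
  rcases hk with rfl | rfl
  · refine (trilinearConv_le m2 m1 m0 (M := M) fun η => ?_).trans ?_
    · refine le_trans (measure_mono ?_) (hvol' η 0)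
      rintro t ⟨ht1, ht0⟩
      refine ⟨?_, ht1, ht0⟩
      rw [sub_zero, scaledSpatialPart_apply]
      exact norm_spatialPart_le_of_mem (s1 _ ht1)
    · gcongr
      exact le_mul_of_one_le_left' one_le_two
  · refine trilinearConv_le_of_localized m2 m1 m0 (π := scaledSpatialPart) (r := 2 * 2 ^ k)
      (by positivity) (fun η hη => ?_) hvol'
    rw [scaledSpatialPart_apply]
    exact norm_spatialPart_le_of_mem (s2 _ hη)

/-- With `F₀` outermost both remaining cones have speed `1`, so the ellipse bound applies with `R =
2 * 2 ^ k₁`. -/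
theorem exists_trilinearConv_parallel_le_aux :
    ∃ C : ℝ≥0, ∀ {F₀ F₁ F₂ : SpaceTime → ℝ≥0∞} {k₁ l₁ l₂ : ℕ} {N₂ : ℝ},
      Measurable F₀ → Measurable F₁ → Measurable F₂ →
      SupportedOn F₁ (dyadicRegion (-1) 1 (2 ^ k₁) (2 ^ l₁)) →
      SupportedOn F₂ (dyadicRegion (-1) 1 N₂ (2 ^ l₂)) →
      trilinearConv F₀ F₁ F₂ ≤ C * 2 ^ ((3 / 2 * (k₁ : ℝ) + l₁ + l₂) / 2) *
        (lnorm F₀ * lnorm F₁ * lnorm F₂) := by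
  refine ⟨NNReal.sqrt (384 * Real.pi * (2 * √2)).toNNReal, ?_⟩
  intro F₀ F₁ F₂ k₁ l₁ l₂ N₂ m0 m1 m2 s1 s2
  rw [← ofReal_mul_two_rpow_rpow_half (by positivity)]
  refine trilinearConv_le m0 m1 m2 fun η => ?_
  refine le_trans (le_trans (measure_mono ?_) (volume_preimage_two_pi_smul_le _))
    ((volume_cones_le ((2 * Real.pi) • η) (R := 2 * 2 ^ k₁) (L₁ := 2 ^ l₁) (L₂ := 2 ^ l₂)
      (by positivity) (one_le_pow₀ one_le_two) (one_le_pow₀ one_le_two)).trans (le_of_eq ?_))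
  · rintro t ⟨ht1, ht2⟩
    refine ⟨norm_spatialPart_le_of_mem (s1 _ ht1), abs_modulation_le_of_mem_neg (s1 _ ht1), ?_⟩
    have := abs_modulation_le_of_mem_neg (s2 _ ht2)
    rwa [smul_sub] at this
  · have h : (2 : ℝ) ^ (3 / 2 * (k₁ : ℝ)) = 2 ^ k₁ * √(2 ^ k₁) := by
      rw [Real.sqrt_eq_rpow, ← Real.rpow_natCast, ← Real.rpow_mul zero_le_two,
        ← Real.rpow_add two_pos]
      congr 1
      ring
    rw [Real.rpow_add two_pos, Real.rpow_add two_pos, Real.rpow_natCast, Real.rpow_natCast, h,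
      Real.sqrt_mul zero_le_two]
    congr 1
    ring

theorem exists_trilinearConv_parallel_le :
    ∃ C : ℝ≥0, ∀ {F₀ F₁ F₂ : SpaceTime → ℝ≥0∞} {k₁ k₂ l₁ l₂ : ℕ},
      Measurable F₀ → Measurable F₁ → Measurable F₂ →
      SupportedOn F₁ (dyadicRegion (-1) 1 (2 ^ k₁) (2 ^ l₁)) →
      SupportedOn F₂ (dyadicRegion (-1) 1 (2 ^ k₂) (2 ^ l₂)) → ∀ k, k = k₁ ∨ k = k₂ →
      trilinearConv F₀ F₁ F₂ ≤ C * 2 ^ ((3 / 2 * (k : ℝ) + l₁ + l₂) / 2) *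
        (lnorm F₀ * lnorm F₁ * lnorm F₂) := by
  obtain ⟨C, h⟩ := exists_trilinearConv_parallel_le_aux
  refine ⟨C, fun {F₀ F₁ F₂ k₁ k₂ l₁ l₂} m0 m1 m2 s1 s2 k hk => ?_⟩
  rcases hk with rfl | rfl
  · exact h m0 m1 m2 s1 s2
  · rw [trilinearConv_swap_right]
    refine (h m0 m2 m1 s2 s1).trans (le_of_eq ?_)
    rw [add_right_comm, mul_right_comm (lnorm F₀)]

/-- The trilinear bound in terms of the two smaller modulations. -/
theorem exists_trilinearConv_le {c : ℝ} (hc0 : 0 < c) (hc : c < 1) :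
    ∃ C : ℝ≥0, ∀ {F₀ F₁ F₂ : SpaceTime → ℝ≥0∞} {ε : ℤˣ} {k₀ k₁ k₂ l₀ l₁ l₂ : ℕ},
      Measurable F₀ → Measurable F₁ → Measurable F₂ →
      SupportedOn F₀ (dyadicRegion ε c (2 ^ k₀) (2 ^ l₀)) →
      SupportedOn F₁ (dyadicRegion (-1) 1 (2 ^ k₁) (2 ^ l₁)) →
      SupportedOn F₂ (dyadicRegion (-1) 1 (2 ^ k₂) (2 ^ l₂)) → ∀ k, k = k₁ ∨ k = k₂ →
      ∀ l, l = l₀ ∨ l = l₁ ∨ l = l₂ →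
      trilinearConv F₀ F₁ F₂ ≤ C * 2 ^ (3 / 4 * (k : ℝ) + ((l₀ : ℝ) + l₁ + l₂ - l) / 2) *
        (lnorm F₀ * lnorm F₁ * lnorm F₂) := by
  obtain ⟨C₁, h1⟩ := exists_trilinearConv_transversal_le hc0 hc
  obtain ⟨C₂, h2⟩ := exists_trilinearConv_parallel_le
  refine ⟨max C₁ C₂, fun {F₀ F₁ F₂ ε k₀ k₁ k₂ l₀ l₁ l₂} m0 m1 m2 s0 s1 s2 k hk l hl => ?_⟩
  have hk0 : (0 : ℝ) ≤ k := Nat.cast_nonneg k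
  -- Dropping the modulation of `F₀` leaves two cones of equal speed. Otherwise the pair is
  -- transversal, and its better power `2 ^ (k / 2)` is weakened to `2 ^ (3 k / 4)`.
  rcases hl with rfl | rfl | rfl
  · refine (h2 m0 m1 m2 s1 s2 k hk).trans ?_
    gcongr
    · exact le_max_right _ _
    · exact one_le_two
    · linarith
  · rw [trilinearConv_swap_right, mul_right_comm (lnorm F₀)]
    refine (h1 m0 m2 m1 s0 s2 s1 k hk.symm).trans ?_
    gcongr
    · exact le_max_left _ _
    · exact one_le_two
    · linarith
  · refine (h1 m0 m1 m2 s0 s1 s2 k hk).trans ?_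
    gcongr
    · exact le_max_left _ _
    · exact one_le_two
    · linarith

theorem le_of_trilinearConv_ne_zero {c : ℝ} (hc0 : 0 < c) (hc : c < 1) {ε : ℤˣ}
    {N₀ N₁ N₂ L₀ L₁ L₂ m : ℝ} (s0 : SupportedOn F₀ (dyadicRegion ε c N₀ L₀))
    (s1 : SupportedOn F₁ (dyadicRegion (-1) 1 N₁ L₁))
    (s2 : SupportedOn F₂ (dyadicRegion (-1) 1 N₂ L₂)) (hF : trilinearConv F₀ F₁ F₂ ≠ 0)
    (hm : 1 ≤ m) (hm0 : L₀ ≤ m) (hm1 : L₁ ≤ m) (hm2 : L₂ ≤ m) :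
    N₀ ≤ 7 / (1 - c) * m ∧ N₁ ≤ 7 / (1 - c) * m ∧ N₂ ≤ 7 / (1 - c) * m := by
  have : ∃ η t, F₀ (-η) * (F₁ t * F₂ (η - t)) ≠ 0 := by
    by_contra! h
    refine hF ?_
    unfold trilinearConv
    refine (lintegral_congr fun η => ?_).trans lintegral_zero
    rcases eq_or_ne (F₀ (-η)) 0 with h0 | h0
    · simp [h0]
    · have : ∀ t, F₁ t * F₂ (η - t) = 0 := fun t => (mul_eq_zero.1 (h η t)).resolve_left h0
      simp [this]
  obtain ⟨η, t, h⟩ := this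
  refine le_of_mem_dyadicRegion hc0 hc (s0 _ (left_ne_zero_of_mul h))
    (s1 _ (left_ne_zero_of_mul (right_ne_zero_of_mul h)))
    (s2 _ (right_ne_zero_of_mul (right_ne_zero_of_mul h))) ?_ hm hm0 hm1 hm2
  rw [smul_neg, smul_sub]
  abel

end Trilinear

/-! ### From supported functions to the dyadic pieces of Schwartz functions. -/

section Symbol

/-- The Fourier transform of `dyadicPiece ε c k l f`. -/
noncomputable def dyadicSymbol (ε : ℤˣ) (c : ℝ) (k l : ℕ) (f : 𝓢(SpaceTime, ℂ)) :
    SpaceTime → ℂ :=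
  fun η => (dyadicRegion ε c (2 ^ k) (2 ^ l)).indicator (fun _ => (1 : ℂ)) ((2 * Real.pi) • η) *
    𝓕 (f : SpaceTime → ℂ) η

variable (ε : ℤˣ) (c : ℝ) (k l : ℕ) (f : 𝓢(SpaceTime, ℂ))

theorem measurable_dyadicSymbol : Measurable (dyadicSymbol ε c k l f) := by
  refine Measurable.mul ?_ ?_
  · exact (measurable_const.indicator (measurableSet_dyadicRegion _ _ _ _)).comp
      (measurable_const_smul _)
  · rw [← SchwartzMap.fourier_coe]
    exact (𝓕 f).continuous.measurable

theorem norm_dyadicSymbol_le (η : SpaceTime) : ‖dyadicSymbol ε c k l f η‖ ≤ ‖𝓕 f η‖ := by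
  unfold dyadicSymbol
  rw [norm_mul, ← SchwartzMap.fourier_coe]
  refine mul_le_of_le_one_left (norm_nonneg _) ((norm_indicator_le_norm_self _ _).trans ?_)
  simp

theorem integrable_dyadicSymbol : Integrable (dyadicSymbol ε c k l f) :=
  (𝓕 f).integrable.mono (measurable_dyadicSymbol ε c k l f).aestronglyMeasurable
    (ae_of_all _ (norm_dyadicSymbol_le ε c k l f))

theorem exists_norm_dyadicSymbol_le : ∃ B, ∀ η, ‖dyadicSymbol ε c k l f η‖ ≤ B :=
  ⟨_, fun η => (norm_dyadicSymbol_le ε c k l f η).trans (SchwartzMap.norm_le_seminorm ℝ (𝓕 f) η)⟩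

theorem memLp_dyadicSymbol : MemLp (dyadicSymbol ε c k l f) 2 :=
  memLp_two_of_integrable_of_bound (integrable_dyadicSymbol ε c k l f)
    (exists_norm_dyadicSymbol_le ε c k l f).choose_spec

theorem supportedOn_dyadicSymbol :
    SupportedOn (fun η => ‖dyadicSymbol ε c k l f η‖ₑ) (dyadicRegion ε c (2 ^ k) (2 ^ l)) := by
  intro η hη
  by_contra h
  refine hη ?_
  simp [dyadicSymbol, h]

theorem eLpNorm_dyadicPiece : eLpNorm (dyadicPiece ε c k l f) 2 volume =
    lnorm (fun η => ‖dyadicSymbol ε c k l f η‖ₑ) := by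
  have := eLpNorm_fourierInv (integrable_dyadicSymbol ε c k l f) (memLp_dyadicSymbol ε c k l f)
  rw [eLpNorm_eq_lintegral_rpow_enorm_toReal (f := dyadicSymbol ε c k l f) two_ne_zero
    ENNReal.ofNat_ne_top] at this
  exact this

variable {ε c k l f}

/-- The trilinear estimate for dyadic pieces, and its non-resonance restriction. -/
theorem exists_enorm_integral_dyadicPiece_le {c : ℝ} (hc0 : 0 < c) (hc : c < 1) :
    ∃ C : ℝ≥0, ∃ ρ : ℝ, 0 ≤ ρ ∧ ∀ (ε : ℤˣ) (f g₁ g₂ : 𝓢(SpaceTime, ℂ)) (k₀ k₁ k₂ l₀ l₁ l₂ l : ℕ),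
      (l = l₀ ∨ l = l₁ ∨ l = l₂) → l₀ ≤ l → l₁ ≤ l → l₂ ≤ l →
      ∫ z, dyadicPiece ε c k₀ l₀ f z * dyadicPiece (-1) 1 k₁ l₁ g₁ z *
        dyadicPiece (-1) 1 k₂ l₂ g₂ z ≠ 0 →
      (k₀ : ℝ) ≤ l + ρ ∧ (k₁ : ℝ) ≤ l + ρ ∧ (k₂ : ℝ) ≤ l + ρ ∧ ∀ k, k = k₁ ∨ k = k₂ →
      ‖∫ z, dyadicPiece ε c k₀ l₀ f z * dyadicPiece (-1) 1 k₁ l₁ g₁ z *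
        dyadicPiece (-1) 1 k₂ l₂ g₂ z‖ₑ ≤
      C * 2 ^ (3 / 4 * (k : ℝ) + ((l₀ : ℝ) + l₁ + l₂ - l) / 2) *
        (eLpNorm (dyadicPiece ε c k₀ l₀ f) 2 volume *
          eLpNorm (dyadicPiece (-1) 1 k₁ l₁ g₁) 2 volume *
          eLpNorm (dyadicPiece (-1) 1 k₂ l₂ g₂) 2 volume) := by
  obtain ⟨C, hC⟩ := exists_trilinearConv_le hc0 hc
  have hc' : 0 < 1 - c := by linarith
  have h7 : 1 ≤ 7 / (1 - c) := by rw [le_div_iff₀ hc']; linarith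
  refine ⟨C, Real.logb 2 (7 / (1 - c)), Real.logb_nonneg one_lt_two h7, ?_⟩
  intro ε f g₁ g₂ k₀ k₁ k₂ l₀ l₁ l₂ l hl h0 h1 h2 hne
  obtain ⟨B, hB⟩ := exists_norm_dyadicSymbol_le (-1) 1 k₂ l₂ g₂
  have hle := enorm_integral_fourierInv_mul_mul_le (integrable_dyadicSymbol ε c k₀ l₀ f)
    (memLp_dyadicSymbol ε c k₀ l₀ f) (integrable_dyadicSymbol (-1) 1 k₁ l₁ g₁)
    (integrable_dyadicSymbol (-1) 1 k₂ l₂ g₂) hB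
  have s0 := supportedOn_dyadicSymbol ε c k₀ l₀ f
  have s1 := supportedOn_dyadicSymbol (-1) 1 k₁ l₁ g₁
  have s2 := supportedOn_dyadicSymbol (-1) 1 k₂ l₂ g₂
  have hT : trilinearConv (fun x => ‖dyadicSymbol ε c k₀ l₀ f x‖ₑ)
      (fun x => ‖dyadicSymbol (-1) 1 k₁ l₁ g₁ x‖ₑ)
      (fun x => ‖dyadicSymbol (-1) 1 k₂ l₂ g₂ x‖ₑ) ≠ 0 := by
    intro h
    rw [h, nonpos_iff_eq_zero, enorm_eq_zero] at hle
    exact hne hle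
  have two (n : ℕ) (hn : n ≤ l) : (2 : ℝ) ^ n ≤ 2 ^ l := pow_le_pow_right₀ one_le_two hn
  obtain ⟨r0, r1, r2⟩ := le_of_trilinearConv_ne_zero hc0 hc s0 s1 s2 hT (m := 2 ^ l)
    (one_le_pow₀ one_le_two) (two _ h0) (two _ h1) (two _ h2)
  have conv (n : ℕ) (hn : (2 : ℝ) ^ n ≤ 7 / (1 - c) * 2 ^ l) :
      (n : ℝ) ≤ l + Real.logb 2 (7 / (1 - c)) := by
    have := Real.logb_le_logb_of_le one_lt_two (by positivity) hn
    rw [Real.logb_mul (by positivity) (by positivity), Real.logb_pow, Real.logb_pow,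
      Real.logb_self_eq_one one_lt_two] at this
    linarith
  refine ⟨conv _ r0, conv _ r1, conv _ r2, fun k hk => hle.trans ?_⟩
  rw [eLpNorm_dyadicPiece, eLpNorm_dyadicPiece, eLpNorm_dyadicPiece]
  exact hC (measurable_dyadicSymbol _ _ _ _ _).enorm (measurable_dyadicSymbol _ _ _ _ _).enorm
    (measurable_dyadicSymbol _ _ _ _ _).enorm s0 s1 s2 k hk l hl

end Symbol
end DyadicPieces

/-! ### Comparison of exponents and summation over dyadic numbers. -/

section Summation

/-- One of the three frequency configurations over which `dyadicSum A` runs. -/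
def FrequencyConfiguration (A : ℝ) (k₀ k₁ k₂ : ℕ) : Prop :=
  LowHighHigh A k₀ k₁ k₂ ∨ LowHighHigh A k₁ k₀ k₂ ∨ LowHighHigh A k₂ k₀ k₁

theorem LowHighHigh.le_add {A : ℝ} (hA : 1 ≤ A) {i j m : ℕ} (h : LowHighHigh A i j m) :
    (i : ℝ) ≤ j + Real.logb 2 A ∧ (j : ℝ) ≤ m + Real.logb 2 A ∧ (m : ℝ) ≤ j + Real.logb 2 A := by
  have conv (p q : ℕ) (hn : (2 : ℝ) ^ p ≤ A * 2 ^ q) : (p : ℝ) ≤ q + Real.logb 2 A := by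
    have := Real.logb_le_logb_of_le one_lt_two (by positivity) hn
    rw [Real.logb_mul (by positivity) (by positivity), Real.logb_pow, Real.logb_pow,
      Real.logb_self_eq_one one_lt_two] at this
    linarith
  exact ⟨conv _ _ h.1, conv _ _ h.2.1, conv _ _ h.2.2⟩

/-- Up to constants, `l` dominates each frequency index, so `17/36 * l` may be spent on any of them.
With all indices equal and `s = -13/18`, both inequalities become `3/4 = 1 - 13/18 + 17/36`. -/
theorem exists_exponent_le {s : ℝ} (hs : -(13 / 18) < s) (hs0 : s < 0) {A : ℝ} (hA : 1 ≤ A)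
    {ρ : ℝ} (hρ : 0 ≤ ρ) {k₀ k₁ k₂ l : ℕ} (h : FrequencyConfiguration A k₀ k₁ k₂)
    (h0 : (k₀ : ℝ) ≤ l + ρ) (h1 : (k₁ : ℝ) ≤ l + ρ) (h2 : (k₂ : ℝ) ≤ l + ρ) :
    ∃ k, (k = k₁ ∨ k = k₂) ∧
      3 / 4 * (k : ℝ) ≤ k₁ + s * (k₀ + k₁ - k₂) + 17 / 36 * l + 10 * (Real.logb 2 A + ρ) ∧
      3 / 4 * (k : ℝ) ≤ k₁ + k₂ - k₀ + s * (k₁ + k₂ - k₀) + 17 / 36 * l +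
        10 * (Real.logb 2 A + ρ) := by
  have ha : 0 ≤ Real.logb 2 A := Real.logb_nonneg one_lt_two hA
  set a := Real.logb 2 A
  have p0 : (0 : ℝ) ≤ k₀ := Nat.cast_nonneg _
  have p1 : (0 : ℝ) ≤ k₁ := Nat.cast_nonneg _
  have p2 : (0 : ℝ) ≤ k₂ := Nat.cast_nonneg _
  have q0 : 0 ≤ -s := by linarith
  have q1 : 0 ≤ s + 13 / 18 := by linarith
  rcases h with h | h | h
  · obtain ⟨r1, r2, r3⟩ := h.le_add hA
    refine ⟨k₁, Or.inl rfl, ?_, ?_⟩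
    · have t1 := mul_nonneg q0 (sub_nonneg.2 r1)
      have t2 := mul_nonneg q0 (sub_nonneg.2 r2)
      have t3 := mul_nonneg q1 p1
      have t4 := mul_nonneg q1 ha
      nlinarith
    · have t1 := mul_nonneg q1 (sub_nonneg.2 r1)
      have t2 := mul_nonneg q1 (sub_nonneg.2 r2)
      have t3 := mul_nonneg q1 p1
      have t4 := mul_nonneg q0 ha
      nlinarith
  · obtain ⟨r1, r2, r3⟩ := h.le_add hA
    refine ⟨k₁, Or.inl rfl, ?_, ?_⟩
    · have t1 := mul_nonneg q0 (sub_nonneg.2 r2)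
      have t3 := mul_nonneg q1 p1
      have t4 := mul_nonneg q1 ha
      nlinarith
    · have t1 := mul_nonneg q1 (sub_nonneg.2 r2)
      have t3 := mul_nonneg q1 p1
      have t4 := mul_nonneg q0 ha
      nlinarith
  -- Here `k₂` may be far below `k₀ ∼ k₁`, and near the endpoint `3/4 * k₁` would be too large, so
  -- `k` must be the lower index.
  · obtain ⟨r1, r2, r3⟩ := h.le_add hA
    refine ⟨k₂, Or.inr rfl, ?_, ?_⟩
    · have t1 := mul_nonneg q1 (sub_nonneg.2 r1)
      have t2 := mul_nonneg q0 (sub_nonneg.2 r2)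
      have t3 := mul_nonneg q1 p1
      have t4 := mul_nonneg q1 ha
      have t5 := mul_nonneg q0 ha
      nlinarith
    · have t1 := mul_nonneg q1 (sub_nonneg.2 r2)
      have t3 := mul_nonneg q1 p2
      have t4 := mul_nonneg q0 ha
      nlinarith

/-- A single term bounds the norm from below. This suffices because the geometric weights make the
dyadic sums converge without orthogonality between pieces. -/
theorem two_rpow_mul_eLpNorm_le_bourgainNorm (ε : ℤˣ) (c s b : ℝ) (k l : ℕ)
    (f : 𝓢(SpaceTime, ℂ)) :
    2 ^ (s * k + b * l) * eLpNorm (dyadicPiece ε c k l f) 2 volume ≤ bourgainNorm ε c s b f := by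
  unfold bourgainNorm
  refine le_trans (le_of_eq ?_) (ENNReal.rpow_le_rpow ((ENNReal.le_tsum l).trans
    (ENNReal.le_tsum k)) (by norm_num))
  rw [ENNReal.mul_rpow_of_nonneg _ _ (by norm_num), ← ENNReal.rpow_natCast 2 k,
    ← ENNReal.rpow_natCast 2 l, ← ENNReal.rpow_mul, ← ENNReal.rpow_mul, two_rpow_mul_two_rpow,
    ← ENNReal.rpow_mul, ← ENNReal.rpow_natCast (eLpNorm _ _ _) 2, ← ENNReal.rpow_mul]
  norm_num
  congr 1
  ring_nf

/-- The geometric weight used to sum over dyadic numbers. -/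
noncomputable def geomWeight (n : ℕ) : ℝ≥0∞ := 2 ^ (-(1 / 1000) * (n : ℝ))

theorem tsum_geomWeight_ne_top : ∑' n, geomWeight n ≠ ⊤ := by
  have h : ∀ n, geomWeight n = ((2 : ℝ≥0∞) ^ (-(1 / 1000) : ℝ)) ^ n := fun n => by
    rw [geomWeight, ENNReal.rpow_mul, ENNReal.rpow_natCast]
  simp_rw [h]
  rw [ENNReal.tsum_geometric]
  refine ENNReal.inv_ne_top.2 (fun h0 => (tsub_eq_zero_iff_le.1 h0).not_gt ?_)
  exact ENNReal.rpow_lt_one_of_one_lt_of_neg ENNReal.one_lt_two (by norm_num)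

theorem tsum_tsum_tsum_geomWeight (B : ℝ≥0∞) :
    ∑' (i : ℕ) (j : ℕ) (m : ℕ), B * (geomWeight i * geomWeight j * geomWeight m) =
      B * (∑' n, geomWeight n) ^ 3 := by
  simp_rw [ENNReal.tsum_mul_left, ENNReal.tsum_mul_right, ENNReal.tsum_mul_left,
    ENNReal.tsum_mul_right]
  ring

theorem dyadicSum_le {A : ℝ} {I : ℕ → ℕ → ℕ → ℝ≥0∞} {B : ℝ≥0∞}
    (h : ∀ k₀ k₁ k₂, FrequencyConfiguration A k₀ k₁ k₂ →
      I k₀ k₁ k₂ ≤ B * (geomWeight k₀ * geomWeight k₁ * geomWeight k₂)) :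
    dyadicSum A I ≤ 3 * (B * (∑' n, geomWeight n) ^ 3) := by
  have total (P : ℕ × ℕ × ℕ → Prop)
      (hP : ∀ k, P k → FrequencyConfiguration A k.1 k.2.1 k.2.2) :
      ∑' k : {k : ℕ × ℕ × ℕ // P k}, I k.1.1 k.1.2.1 k.1.2.2 ≤ B * (∑' n, geomWeight n) ^ 3 := by
    calc _ ≤ ∑' k : {k : ℕ × ℕ × ℕ // P k},
          B * (geomWeight k.1.1 * geomWeight k.1.2.1 * geomWeight k.1.2.2) :=
          ENNReal.tsum_le_tsum fun k => h _ _ _ (hP _ k.2)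
      _ ≤ ∑' k : ℕ × ℕ × ℕ, B * (geomWeight k.1 * geomWeight k.2.1 * geomWeight k.2.2) :=
          ENNReal.tsum_comp_le_tsum_of_injective Subtype.val_injective
            (fun k : ℕ × ℕ × ℕ => B * (geomWeight k.1 * geomWeight k.2.1 * geomWeight k.2.2))
      _ = _ := by
          rw [← tsum_tsum_tsum_geomWeight, ENNReal.tsum_prod']
          simp_rw [ENNReal.tsum_prod']
  unfold dyadicSum
  calc _ ≤ B * (∑' n, geomWeight n) ^ 3 + B * (∑' n, geomWeight n) ^ 3 +
        B * (∑' n, geomWeight n) ^ 3 :=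
        add_le_add (add_le_add (total _ fun k hk => Or.inl hk) (total _ fun k hk => Or.inr (Or.inl hk)))
          (total _ fun k hk => Or.inr (Or.inr hk))
    _ = _ := by ring

/-- Summation of the trilinear estimate against the weights of the three Bourgain norms. -/
theorem dyadicSum_mul_modulationSum_le {A : ℝ} {ω : ℕ → ℕ → ℕ → ℝ} {C : ℝ≥0∞}
    {s₀ b₀ s₁ b₁ s₂ b₂ c : ℝ} {ε : ℤˣ} {f g₁ g₂ : 𝓢(SpaceTime, ℂ)}
    {κ : ℝ} (h : ∀ k₀ k₁ k₂ l₀ l₁ l₂ : ℕ, FrequencyConfiguration A k₀ k₁ k₂ →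
      ∫ z, dyadicPiece ε c k₀ l₀ f z * dyadicPiece (-1) 1 k₁ l₁ g₁ z *
        dyadicPiece (-1) 1 k₂ l₂ g₂ z ≠ 0 →
      ∃ E : ℝ, ω k₀ k₁ k₂ + E ≤ κ - 1 / 1000 * (k₀ + k₁ + k₂ + l₀ + l₁ + l₂) +
          (s₀ * k₀ + b₀ * l₀) + (s₁ * k₁ + b₁ * l₁) + (s₂ * k₂ + b₂ * l₂) ∧
        ‖∫ z, dyadicPiece ε c k₀ l₀ f z * dyadicPiece (-1) 1 k₁ l₁ g₁ z *
          dyadicPiece (-1) 1 k₂ l₂ g₂ z‖ₑ ≤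
        C * 2 ^ E * (eLpNorm (dyadicPiece ε c k₀ l₀ f) 2 volume *
          eLpNorm (dyadicPiece (-1) 1 k₁ l₁ g₁) 2 volume *
          eLpNorm (dyadicPiece (-1) 1 k₂ l₂ g₂) 2 volume)) :
    dyadicSum A (fun k₀ k₁ k₂ => 2 ^ ω k₀ k₁ k₂ * modulationSum ε c f g₁ g₂ k₀ k₁ k₂) ≤
      3 * (C * 2 ^ κ * (∑' n, geomWeight n) ^ 6) * bourgainNorm ε c s₀ b₀ f *
        bourgainNorm (-1) 1 s₁ b₁ g₁ * bourgainNorm (-1) 1 s₂ b₂ g₂ := by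
  set X := bourgainNorm ε c s₀ b₀ f * bourgainNorm (-1) 1 s₁ b₁ g₁ * bourgainNorm (-1) 1 s₂ b₂ g₂
    with hX
  refine (dyadicSum_le (B := C * 2 ^ κ * X * (∑' n, geomWeight n) ^ 3) ?_).trans
    (le_of_eq (by rw [hX]; ring))
  intro k₀ k₁ k₂ hk
  have term : ∀ l₀ l₁ l₂ : ℕ, 2 ^ ω k₀ k₁ k₂ *
      ‖∫ z, dyadicPiece ε c k₀ l₀ f z * dyadicPiece (-1) 1 k₁ l₁ g₁ z *
        dyadicPiece (-1) 1 k₂ l₂ g₂ z‖ₑ ≤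
      C * 2 ^ κ * X * (geomWeight k₀ * geomWeight k₁ * geomWeight k₂) *
        (geomWeight l₀ * geomWeight l₁ * geomWeight l₂) := by
    intro l₀ l₁ l₂
    -- Vanishing integrals are set aside, since the frequency restriction holds only for nonzero
    -- ones.
    by_cases h0 : ∫ z, dyadicPiece ε c k₀ l₀ f z * dyadicPiece (-1) 1 k₁ l₁ g₁ z *
        dyadicPiece (-1) 1 k₂ l₂ g₂ z = 0
    · rw [h0]; simp
    obtain ⟨E, hE, hle⟩ := h k₀ k₁ k₂ l₀ l₁ l₂ hk h0
    have hexp : (2 : ℝ≥0∞) ^ ω k₀ k₁ k₂ * 2 ^ E ≤ 2 ^ κ *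
        (geomWeight k₀ * geomWeight k₁ * geomWeight k₂) *
        (geomWeight l₀ * geomWeight l₁ * geomWeight l₂) * (2 ^ (s₀ * k₀ + b₀ * l₀) *
        2 ^ (s₁ * k₁ + b₁ * l₁) * 2 ^ (s₂ * k₂ + b₂ * l₂)) := by
      simp only [geomWeight, two_rpow_mul_two_rpow]
      refine ENNReal.rpow_le_rpow_of_exponent_le one_le_two (hE.trans (le_of_eq ?_))
      ring
    calc _ ≤ 2 ^ ω k₀ k₁ k₂ * (C * 2 ^ E * (eLpNorm (dyadicPiece ε c k₀ l₀ f) 2 volume *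
          eLpNorm (dyadicPiece (-1) 1 k₁ l₁ g₁) 2 volume *
          eLpNorm (dyadicPiece (-1) 1 k₂ l₂ g₂) 2 volume)) := by gcongr
      _ = C * (2 ^ ω k₀ k₁ k₂ * 2 ^ E) * (eLpNorm (dyadicPiece ε c k₀ l₀ f) 2 volume *
          eLpNorm (dyadicPiece (-1) 1 k₁ l₁ g₁) 2 volume *
          eLpNorm (dyadicPiece (-1) 1 k₂ l₂ g₂) 2 volume) := by ring
      _ ≤ _ := mul_le_mul_left (mul_le_mul_right hexp _) _
      _ = C * 2 ^ κ * ((2 ^ (s₀ * k₀ + b₀ * l₀) * eLpNorm (dyadicPiece ε c k₀ l₀ f) 2 volume) *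
          (2 ^ (s₁ * k₁ + b₁ * l₁) * eLpNorm (dyadicPiece (-1) 1 k₁ l₁ g₁) 2 volume) *
          (2 ^ (s₂ * k₂ + b₂ * l₂) * eLpNorm (dyadicPiece (-1) 1 k₂ l₂ g₂) 2 volume)) *
          (geomWeight k₀ * geomWeight k₁ * geomWeight k₂) *
          (geomWeight l₀ * geomWeight l₁ * geomWeight l₂) := by ring
      _ ≤ _ := by
          rw [hX]
          gcongr <;> exact two_rpow_mul_eLpNorm_le_bourgainNorm _ _ _ _ _ _ _
  unfold modulationSum
  calc _ = ∑' (l₀ : ℕ) (l₁ : ℕ) (l₂ : ℕ), 2 ^ ω k₀ k₁ k₂ *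
        ‖∫ z, dyadicPiece ε c k₀ l₀ f z * dyadicPiece (-1) 1 k₁ l₁ g₁ z *
          dyadicPiece (-1) 1 k₂ l₂ g₂ z‖ₑ := by simp_rw [ENNReal.tsum_mul_left]
    _ ≤ ∑' (l₀ : ℕ) (l₁ : ℕ) (l₂ : ℕ),
        C * 2 ^ κ * X * (geomWeight k₀ * geomWeight k₁ * geomWeight k₂) *
          (geomWeight l₀ * geomWeight l₁ * geomWeight l₂) :=
        ENNReal.tsum_le_tsum fun l₀ => ENNReal.tsum_le_tsum fun l₁ =>
          ENNReal.tsum_le_tsum fun l₂ => term l₀ l₁ l₂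
    _ = _ := by rw [tsum_tsum_tsum_geomWeight]; ring

end Summation

/-! ### Choice of `b` and conclusion. -/

theorem mainTheorem7 (s : ℝ) (hs : s ∈ Set.Ioo (-(13 / 18) : ℝ) 0) :
    ∃ b ∈ Set.Ioo (1 / 2 : ℝ) 1, ∀ c ∈ Set.Ioo (0 : ℝ) 1, ∀ A : ℝ, 1 ≤ A →
      ∃ C : ℝ≥0, ∀ (ε : ℤˣ) (f g₁ g₂ : 𝓢(SpaceTime, ℂ)),
        dyadicSum A (trilinearOne ε c f g₁ g₂) ≤
            C * bourgainNorm ε c s b f * bourgainNorm (-1) 1 s b g₁ *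
              bourgainNorm (-1) 1 (-s) (1 - b) g₂ ∧
        dyadicSum A (trilinearTwo ε c f g₁ g₂) ≤
            C * bourgainNorm ε c (-s) (1 - b) f * bourgainNorm (-1) 1 s b g₁ *
              bourgainNorm (-1) 1 s b g₂ := by
  -- One `b` serves all `s`: the largest modulation keeps at least the power `1 - b = 49/100`, which
  -- exceeds `17/36` by more than the `6/1000` used by the six geometric weights.
  refine ⟨51 / 100, by norm_num, fun c hc A hA => ?_⟩
  obtain ⟨C, ρ, hρ, hC⟩ := exists_enorm_integral_dyadicPiece_le hc.1 hc.2
  -- The first summand is the loss in `exists_exponent_le`; `3 * ρ` covers replacing the three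
  -- frequency indices by `l + ρ` in the geometric weights.
  set κ := 10 * (Real.logb 2 A + ρ) + 3 * ρ with hκ
  have hfin : 3 * ((C : ℝ≥0∞) * 2 ^ κ * (∑' n, geomWeight n) ^ 6) ≠ ⊤ :=
    ENNReal.mul_ne_top ENNReal.ofNat_ne_top (ENNReal.mul_ne_top (ENNReal.mul_ne_top
      ENNReal.coe_ne_top (ENNReal.rpow_ne_top_of_ne_zero two_ne_zero ENNReal.ofNat_ne_top))
      (ENNReal.pow_ne_top tsum_geomWeight_ne_top))
  have hmax : ∀ l₀ l₁ l₂ : ℕ, ∃ l, (l = l₀ ∨ l = l₁ ∨ l = l₂) ∧ l₀ ≤ l ∧ l₁ ≤ l ∧ l₂ ≤ l := by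
    intro l₀ l₁ l₂
    exact ⟨max l₀ (max l₁ l₂), by grind, by grind, by grind, by grind⟩
  refine ⟨(3 * ((C : ℝ≥0∞) * 2 ^ κ * (∑' n, geomWeight n) ^ 6)).toNNReal, fun ε f g₁ g₂ => ?_⟩
  rw [ENNReal.coe_toNNReal hfin]
  constructor
  · have e : trilinearOne ε c f g₁ g₂ = fun k₀ k₁ k₂ : ℕ =>
        2 ^ (-(k₁ : ℝ)) * modulationSum ε c f g₁ g₂ k₀ k₁ k₂ := by
      funext k₀ k₁ k₂
      rw [trilinearOne, ENNReal.rpow_neg, ENNReal.rpow_natCast]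
    rw [e]
    refine dyadicSum_mul_modulationSum_le (ω := fun k₀ k₁ k₂ => -(k₁ : ℝ))
      fun k₀ k₁ k₂ l₀ l₁ l₂ hk hne => ?_
    obtain ⟨l, hl, h0, h1, h2⟩ := hmax l₀ l₁ l₂
    obtain ⟨r0, r1, r2, hle⟩ := hC ε f g₁ g₂ k₀ k₁ k₂ l₀ l₁ l₂ l hl h0 h1 h2 hne
    obtain ⟨k, hk12, hE, -⟩ := exists_exponent_le hs.1 hs.2 hA hρ hk r0 r1 r2
    refine ⟨_, ?_, hle k hk12⟩
    have c0 : (l₀ : ℝ) ≤ l := Nat.cast_le.2 h0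
    have c1 : (l₁ : ℝ) ≤ l := Nat.cast_le.2 h1
    have c2 : (l₂ : ℝ) ≤ l := Nat.cast_le.2 h2
    have p0 : (0 : ℝ) ≤ l₀ := Nat.cast_nonneg _
    have p1 : (0 : ℝ) ≤ l₁ := Nat.cast_nonneg _
    have p2 : (0 : ℝ) ≤ l₂ := Nat.cast_nonneg _
    linarith
  · have e : trilinearTwo ε c f g₁ g₂ = fun k₀ k₁ k₂ : ℕ =>
        2 ^ ((k₀ : ℝ) - k₁ - k₂) * modulationSum ε c f g₁ g₂ k₀ k₁ k₂ := by
      funext k₀ k₁ k₂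
      rw [trilinearTwo, sub_eq_add_neg, sub_eq_add_neg, ← two_rpow_mul_two_rpow,
        ← two_rpow_mul_two_rpow, ENNReal.rpow_neg, ENNReal.rpow_neg, ENNReal.rpow_natCast,
        ENNReal.rpow_natCast, ENNReal.rpow_natCast]
    rw [e]
    refine dyadicSum_mul_modulationSum_le (ω := fun k₀ k₁ k₂ => (k₀ : ℝ) - k₁ - k₂)
      fun k₀ k₁ k₂ l₀ l₁ l₂ hk hne => ?_
    obtain ⟨l, hl, h0, h1, h2⟩ := hmax l₀ l₁ l₂
    obtain ⟨r0, r1, r2, hle⟩ := hC ε f g₁ g₂ k₀ k₁ k₂ l₀ l₁ l₂ l hl h0 h1 h2 hne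
    obtain ⟨k, hk12, -, hE⟩ := exists_exponent_le hs.1 hs.2 hA hρ hk r0 r1 r2
    refine ⟨_, ?_, hle k hk12⟩
    have c0 : (l₀ : ℝ) ≤ l := Nat.cast_le.2 h0
    have c1 : (l₁ : ℝ) ≤ l := Nat.cast_le.2 h1
    have c2 : (l₂ : ℝ) ≤ l := Nat.cast_le.2 h2
    have p0 : (0 : ℝ) ≤ l₀ := Nat.cast_nonneg _
    have p1 : (0 : ℝ) ≤ l₁ := Nat.cast_nonneg _
    have p2 : (0 : ℝ) ≤ l₂ := Nat.cast_nonneg _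
    linarith
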